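/- Let $G\subset\mathbb C$ be a convex domain (a non-empty open convex set), let $\Omega=\mathbb C\setminus\overline G$, and for $z\in\Omega$ let $d_z=\mathrm{dist}(z,\partial\Omega)$. For $s=1,2,\dots$ put $$K_s=\frac{s!}{\pi}\max_{\alpha\in\mathbb R}\int_{-\pi/2}^{\pi/2}\bigl|\cos\bigl(\alpha+(s+1)\varphi\bigr)\bigr|\cos^{s-1}\varphi\,d\varphi ,$$ where the maximum is attained. (i) If $f$ is holomorphic in $\Omega$ with bounded real part, then for every $z\in\Omega$ and every $s=1,2,\dots$ $$|f^{(s)}(z)|\le \frac{K_s}{d_z^{\,s}}\,\sup_\Omega|\Re f| .$$ (ii) Let $\mathbb C_+=\{z:\Im z>0\}$. If $f$ is holomorphic in $\mathbb C_+$ with bounded real part, then the boundary values $\lim_{y\to0+}\Re f(x+iy)$ exist for almost every $x\in\mathbb R$ and form an element of $L^\infty(\partial\mathbb C_+)=L^\infty(\mathbb R)$ (Lebesgue measure), whose norm is denoted $\|\Re f\|_{L^\infty(\partial\mathbb C_+)}$. For each $s=1,2,\dots$, $K_s$ is the best (smallest) constant in the inequality $$|f^{(s)}(z)|\le\frac{K_s}{(\Im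 z)^s}\,\|\Re f\|_{L^\infty(\partial\mathbb C_+)},$$ required for all such $f$ and all $z\in\mathbb C_+$. (iii) In particular, $$K_{2l+1}=\frac{2\,[(2l+1)!!]^2}{\pi(2l+1)}\quad(l=0,1,2,\dots),\qquad K_2=\frac{3\sqrt3}{2\pi},\qquad K_4=\frac{3(16+5\sqrt5)}{4\pi}.$$ -/

import Mathlib

open Set Filter Topology MeasureTheory
open scoped Nat

noncomputable section

/-- The integral `∫_{-π/2}^{π/2} |cos (α + (s + 1) φ)| cos^{s-1} φ dφ`
(used only for `s ≥ 1`). -/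
def cosIntegral (s : ℕ) (α : ℝ) : ℝ :=
  ∫ t in (-(Real.pi / 2))..(Real.pi / 2),
    |Real.cos (α + ((s : ℝ) + 1) * t)| * Real.cos t ^ (s - 1)

/-- The constant `K_s = (s! / π) max_α ∫_{-π/2}^{π/2} |cos (α + (s + 1) φ)| cos^{s-1} φ dφ`,
written with a supremum over all real `α`; the main theorem asserts that it is attained. -/
def realPartConst (s : ℕ) : ℝ :=
  (s ! : ℝ) / Real.pi * sSup (range (cosIntegral s))

/-- The set `Ω = ℂ \ closure G`. -/
def exteriorSet (G : Set ℂ) : Set ℂ := (closure G)ᶜ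

/-- The open upper half-plane, as a set of complex numbers. -/
def upperHalf : Set ℂ := {z : ℂ | 0 < z.im}

/-- `f` is holomorphic in the open set `U` and its real part is bounded there. -/
def HolomorphicBddRe (U : Set ℂ) (f : ℂ → ℂ) : Prop :=
  DifferentiableOn ℂ f U ∧ BddAbove ((fun w : ℂ => |(f w).re|) '' U)

/-- The boundary value at the real point `x` of a function on the upper half-plane:
its limit along the vertical ray ending at `x`
(meaningful where this limit exists). -/
def boundaryTrace (u : ℂ → ℝ) (x : ℝ) : ℝ :=
  limUnder (𝓝[>] (0 : ℝ)) (fun y : ℝ => u ((x : ℂ) + (y : ℂ) * Complex.I))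

/-- The norm in `L^∞` of the boundary line of the boundary values of `u`, with respect to
Lebesgue measure. -/
def boundaryNorm (u : ℂ → ℝ) : ℝ :=
  (eLpNorm (boundaryTrace u) ⊤ (volume : Measure ℝ)).toReal

end

/-!
Everything rests on one representation. If `f` is holomorphic in the upper half-plane and `Re f` is
bounded, then for `s ≥ 1`
`f^(s)(z) = s! / (π i) ∫ u(t) (t - z)^(-(s+1)) dt`, where `u` is the boundary trace of `Re f`
(`iteratedDeriv_eq_integral_boundaryTrace`).

On horizontal lines inside the half-plane the Poisson formula is the mean value property carried
over by the Cayley map (`re_eq_integral_of_differentiableOn`). The primitives of `Re f` along these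
lines are Lipschitz with a common constant, so by Arzelà–Ascoli a sequence of them converges to a
Lipschitz function `V`, and an integration by parts expresses `Re f` through difference quotients of
`V` (`exists_lipschitz_primitive`). At every point where `V` is differentiable, hence almost
everywhere, dominated convergence gives the vertical limit of `Re f` (`ae_exists_tendsto_re`). Then
`Re f` is the Poisson integral of its trace, which is the real part of the Cauchy transform of the
trace; so `f` is this Cauchy transform up to a constant.

The real part of the rotated kernel `exp (iβ) (t - z)^(-(s+1))` has `L¹` norm
`cosIntegral s α / (Im z)^s`, where `α` depends on `β` by a shift and a reflection; this is the
substitution `t = x + y tan θ` (`integral_abs_re_kernel`). It gives the estimate with the constant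
`realPartConst s`; the Cauchy transform of the sign of that real part, for a maximizing `α`,
shows that no smaller constant is possible (`realPartConst_le_of_bound`).

Outside a convex set, the half-plane estimate is applied in the half-plane cut off by the supporting
line at the nearest point of the closure (`norm_iteratedDeriv_le_exteriorSet`).

For `s = 2 l + 1` the integral does not depend on `α`: the factor `|cos (α + (s+1) φ)|` has period
`π / (s+1)`, and the average of `cos^(2l)` over `s + 1` equidistant points is constant
(`cosIntegral_odd`). For `s = 2` and `s = 4` the integral is a combination of cosines on
each period, found by splitting at the zeros (`cosIntegral_two`, `cosIntegral_four`), and its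
maximum is that of a polynomial in one cosine.
-/

/-! ### The Cauchy transform of a bounded function on the line -/

/-- The Cauchy transform of a bounded function `g` on the real line, as a function on the upper
half-plane. The term `t / (1 + t ^ 2)` does not depend on `z` and makes the integral converge;
as it is real, the real part of the transform is the Poisson integral of `g`. -/
noncomputable def cauchyTransform (g : ℝ → ℝ) (z : ℂ) : ℂ :=
  ((Real.pi : ℂ) * Complex.I)⁻¹ *
    ∫ t : ℝ, (g t : ℂ) * (((t : ℂ) - z)⁻¹ - (t : ℂ) / (1 + (t : ℂ) ^ 2))

theorem isOpen_upperHalf : IsOpen upperHalf :=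
  isOpen_lt continuous_const Complex.continuous_im

theorem im_le_norm_sub (t : ℝ) {z : ℂ} (hz : 0 < z.im) : z.im ≤ ‖(t : ℂ) - z‖ := by
  have h := Complex.abs_im_le_norm ((t : ℂ) - z)
  simp only [Complex.sub_im, Complex.ofReal_im, zero_sub, abs_neg, abs_of_pos hz] at h
  exact h

theorem ofReal_sub_ne_zero (t : ℝ) {z : ℂ} (hz : 0 < z.im) : (t : ℂ) - z ≠ 0 :=
  norm_pos_iff.1 (hz.trans_le (im_le_norm_sub t hz))

theorem one_add_sq_ne_zero (t : ℝ) : (1 + (t : ℂ) ^ 2) ≠ 0 := by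
  have h : (0 : ℝ) < 1 + t ^ 2 := by positivity
  exact_mod_cast h.ne'

/-- Locally uniformly in `z`, the distance from `t` to `z` dominates `√(1 + t ^ 2)`. -/
theorem exists_one_add_sq_le {z₀ : ℂ} (hz₀ : 0 < z₀.im) :
    ∃ D : ℝ, 0 < D ∧ ∀ z ∈ Metric.ball z₀ (z₀.im / 2), z₀.im / 2 ≤ z.im ∧
      ∀ t : ℝ, 1 + t ^ 2 ≤ D * ‖(t : ℂ) - z‖ ^ 2 := by
  refine ⟨1 + (4 / z₀.im ^ 2) * (1 + 2 * (‖z₀‖ + z₀.im / 2) ^ 2) + 2, by positivity, ?_⟩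
  intro z hz
  rw [Metric.mem_ball, dist_eq_norm] at hz
  have him : z₀.im / 2 ≤ z.im := by
    have := (Complex.abs_im_le_norm (z - z₀)).trans hz.le
    rw [Complex.sub_im, abs_le] at this
    linarith [this.1]
  refine ⟨him, fun t => ?_⟩
  have h1 : z₀.im / 2 ≤ ‖(t : ℂ) - z‖ := him.trans (im_le_norm_sub t (by linarith))
  have h2 : ‖z‖ ≤ ‖z₀‖ + z₀.im / 2 := by
    calc ‖z‖ = ‖z₀ + (z - z₀)‖ := by congr 1; ring
      _ ≤ ‖z₀‖ + ‖z - z₀‖ := norm_add_le _ _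
      _ ≤ _ := by linarith
  have h3 : |t| ≤ ‖(t : ℂ) - z‖ + ‖z‖ := by
    calc |t| = ‖((t : ℂ) - z) + z‖ := by simp
      _ ≤ _ := norm_add_le _ _
  set n := ‖(t : ℂ) - z‖
  set A := ‖z₀‖ + z₀.im / 2
  have hA : 0 ≤ A := by positivity
  have h4 : t ^ 2 ≤ 2 * n ^ 2 + 2 * A ^ 2 := by
    have : t ^ 2 ≤ (n + A) ^ 2 := by
      rw [← sq_abs t]; gcongr; linarith
    nlinarith [sq_nonneg (n - A)]
  have h5 : 1 ≤ (4 / z₀.im ^ 2) * n ^ 2 := by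
    have : (z₀.im / 2) ^ 2 ≤ n ^ 2 := by gcongr
    rw [div_mul_eq_mul_div, le_div_iff₀ (by positivity)]
    nlinarith
  nlinarith [mul_le_mul_of_nonneg_right h5 (show 0 ≤ 1 + 2 * A ^ 2 by positivity), sq_nonneg n]

theorem integrable_const_div_one_add_sq (c : ℝ) :
    Integrable (fun t : ℝ => c * (1 + t ^ 2)⁻¹) :=
  integrable_inv_one_add_sq.const_mul c

theorem norm_inv_pow_sub_le {z₀ : ℂ} (hz₀ : 0 < z₀.im) (k : ℕ) :
    ∃ C : ℝ, ∀ z ∈ Metric.ball z₀ (z₀.im / 2), 0 < z.im ∧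
      ∀ t : ℝ, ‖(((t : ℂ) - z) ^ (k + 2))⁻¹‖ ≤ C * (1 + t ^ 2)⁻¹ := by
  obtain ⟨D, hD, h⟩ := exists_one_add_sq_le hz₀
  refine ⟨(2 / z₀.im) ^ k * D, fun z hz => ?_⟩
  obtain ⟨him, ht⟩ := h z hz
  have hz' : 0 < z.im := by linarith
  refine ⟨hz', fun t => ?_⟩
  have h1 : z₀.im / 2 ≤ ‖(t : ℂ) - z‖ := him.trans (im_le_norm_sub t hz')
  have hn : 0 < ‖(t : ℂ) - z‖ := by linarith
  rw [norm_inv, norm_pow, pow_add, mul_inv, mul_assoc]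
  gcongr ?_ * ?_
  · rw [← inv_pow]
    gcongr
    rw [inv_le_comm₀ hn (by positivity)]
    rw [inv_div]; exact h1
  · rw [inv_le_comm₀ (by positivity) (by positivity), mul_inv, inv_inv,
      inv_mul_le_iff₀ hD]
    exact ht t

section

variable {g : ℝ → ℝ} {b : ℝ}

theorem aestronglyMeasurable_mul_inv_pow (hg : AEStronglyMeasurable g volume) {z : ℂ}
    (hz : 0 < z.im) (k : ℕ) :
    AEStronglyMeasurable (fun t : ℝ => (g t : ℂ) * (((t : ℂ) - z) ^ k)⁻¹) volume := by
  refine (Complex.continuous_ofReal.comp_aestronglyMeasurable hg).mul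
    (Continuous.aestronglyMeasurable ?_)
  exact Continuous.inv₀ (by fun_prop) fun t => pow_ne_zero _ (ofReal_sub_ne_zero t hz)

theorem integrable_mul_inv_pow (hg : AEStronglyMeasurable g volume) (hb : ∀ᵐ t, |g t| ≤ b) {z : ℂ}
    (hz : 0 < z.im) (k : ℕ) :
    Integrable (fun t : ℝ => (g t : ℂ) * (((t : ℂ) - z) ^ (k + 2))⁻¹) := by
  obtain ⟨C, hC⟩ := norm_inv_pow_sub_le hz k
  refine (integrable_const_div_one_add_sq (b * C)).mono'
    (aestronglyMeasurable_mul_inv_pow hg hz _) ?_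
  filter_upwards [hb] with t ht
  rw [norm_mul, Complex.norm_real, Real.norm_eq_abs, mul_assoc]
  exact mul_le_mul ht ((hC z (Metric.mem_ball_self (by positivity))).2 t) (norm_nonneg _)
    ((abs_nonneg _).trans ht)

theorem hasDerivAt_inv_pow_sub (t : ℝ) {z : ℂ} (hz : 0 < z.im) (k : ℕ) :
    HasDerivAt (fun w : ℂ => (((t : ℂ) - w) ^ k)⁻¹)
      ((k : ℂ) * (((t : ℂ) - z) ^ (k + 1))⁻¹) z := by
  have h := (((hasDerivAt_id z).const_sub (t : ℂ)).pow k).inv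
    (pow_ne_zero _ (ofReal_sub_ne_zero t hz))
  refine h.congr_deriv ?_
  have h0 := ofReal_sub_ne_zero t hz
  rcases k with _ | k
  · simp
  · simp only [id, Pi.pow_apply, Nat.add_sub_cancel]
    field_simp
    ring

theorem hasDerivAt_integral_inv_pow (hg : AEStronglyMeasurable g volume)
    (hb : ∀ᵐ t, |g t| ≤ b) {z : ℂ} (hz : 0 < z.im) (k : ℕ) :
    HasDerivAt (fun w : ℂ => ∫ t : ℝ, (g t : ℂ) * (((t : ℂ) - w) ^ (k + 2))⁻¹)
      (((k + 2 : ℕ) : ℂ) * ∫ t : ℝ, (g t : ℂ) * (((t : ℂ) - z) ^ (k + 3))⁻¹) z := by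
  obtain ⟨C, hC⟩ := norm_inv_pow_sub_le hz (k + 1)
  rw [← integral_const_mul]
  refine (hasDerivAt_integral_of_dominated_loc_of_deriv_le
    (F' := fun w t => ((k + 2 : ℕ) : ℂ) * ((g t : ℂ) * (((t : ℂ) - w) ^ (k + 3))⁻¹))
    (bound := fun t => ((k + 2 : ℕ) : ℝ) * (b * (C * (1 + t ^ 2)⁻¹)))
    (Metric.ball_mem_nhds z (half_pos hz)) ?_ (integrable_mul_inv_pow hg hb hz k)
    ((aestronglyMeasurable_mul_inv_pow hg hz _).const_mul _) ?_
    (((integrable_const_div_one_add_sq C).const_mul b).const_mul _) ?_).2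
  · filter_upwards [isOpen_upperHalf.mem_nhds hz] with w hw
    exact aestronglyMeasurable_mul_inv_pow hg hw _
  · filter_upwards [hb] with t ht w hw
    rw [norm_mul, norm_mul, Complex.norm_real, Real.norm_eq_abs, Complex.norm_natCast]
    gcongr
    · exact (abs_nonneg _).trans ht
    · exact (hC w hw).2 t
  · refine ae_of_all _ fun t w hw => ?_
    have := (hasDerivAt_inv_pow_sub t (hC w hw).1 (k + 2)).const_mul (g t : ℂ)
    exact this.congr_deriv (by ring)

theorem cauchyKernel_eq (t : ℝ) {z : ℂ} (hz : 0 < z.im) :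
    ((t : ℂ) - z)⁻¹ - (t : ℂ) / (1 + (t : ℂ) ^ 2) =
      (z + (1 + z ^ 2) * ((t : ℂ) - z)⁻¹) * (1 + (t : ℂ) ^ 2)⁻¹ := by
  have h1 := ofReal_sub_ne_zero t hz
  have h2 := one_add_sq_ne_zero t
  field_simp
  ring

theorem aestronglyMeasurable_mul_cauchyKernel (hg : AEStronglyMeasurable g volume) {z : ℂ}
    (hz : 0 < z.im) :
    AEStronglyMeasurable
      (fun t : ℝ => (g t : ℂ) * (((t : ℂ) - z)⁻¹ - (t : ℂ) / (1 + (t : ℂ) ^ 2))) volume := by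
  refine (Complex.continuous_ofReal.comp_aestronglyMeasurable hg).mul
    (Continuous.aestronglyMeasurable ?_)
  refine Continuous.sub (Continuous.inv₀ (by fun_prop) fun t => ofReal_sub_ne_zero t hz)
    (Continuous.div (by fun_prop) (by fun_prop) one_add_sq_ne_zero)

theorem integrable_mul_cauchyKernel (hg : AEStronglyMeasurable g volume)
    (hb : ∀ᵐ t, |g t| ≤ b) {z : ℂ} (hz : 0 < z.im) :
    Integrable
      (fun t : ℝ => (g t : ℂ) * (((t : ℂ) - z)⁻¹ - (t : ℂ) / (1 + (t : ℂ) ^ 2))) := by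
  refine (integrable_const_div_one_add_sq (b * (‖z‖ + ‖1 + z ^ 2‖ * z.im⁻¹))).mono'
    (aestronglyMeasurable_mul_cauchyKernel hg hz) ?_
  filter_upwards [hb] with t ht
  rw [cauchyKernel_eq t hz, norm_mul, Complex.norm_real, Real.norm_eq_abs, mul_assoc, norm_mul]
  have h1 : ‖(1 + (t : ℂ) ^ 2)⁻¹‖ = (1 + t ^ 2)⁻¹ := by
    rw [norm_inv]
    have : ((1 + t ^ 2 : ℝ) : ℂ) = 1 + (t : ℂ) ^ 2 := by push_cast; rfl
    rw [← this, Complex.norm_real, Real.norm_eq_abs, abs_of_pos (by positivity)]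
  rw [h1]
  gcongr
  · exact (abs_nonneg _).trans ht
  · refine (norm_add_le _ _).trans ?_
    rw [norm_mul, norm_inv]
    gcongr
    exact im_le_norm_sub t hz

theorem hasDerivAt_cauchyTransform (hg : AEStronglyMeasurable g volume)
    (hb : ∀ᵐ t, |g t| ≤ b) {z : ℂ} (hz : 0 < z.im) :
    HasDerivAt (cauchyTransform g)
      (((Real.pi : ℂ) * Complex.I)⁻¹ * ∫ t : ℝ, (g t : ℂ) * (((t : ℂ) - z) ^ 2)⁻¹) z := by
  obtain ⟨C, hC⟩ := norm_inv_pow_sub_le hz 0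
  refine HasDerivAt.const_mul _ ?_
  refine (hasDerivAt_integral_of_dominated_loc_of_deriv_le
    (F' := fun w t => (g t : ℂ) * (((t : ℂ) - w) ^ 2)⁻¹)
    (bound := fun t => b * (C * (1 + t ^ 2)⁻¹))
    (Metric.ball_mem_nhds z (half_pos hz)) ?_ (integrable_mul_cauchyKernel hg hb hz)
    (aestronglyMeasurable_mul_inv_pow hg hz _) ?_
    ((integrable_const_div_one_add_sq C).const_mul b) ?_).2
  · filter_upwards [isOpen_upperHalf.mem_nhds hz] with w hw
    exact aestronglyMeasurable_mul_cauchyKernel hg hw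
  · filter_upwards [hb] with t ht w hw
    rw [norm_mul, Complex.norm_real, Real.norm_eq_abs]
    gcongr
    · exact (abs_nonneg _).trans ht
    · exact (hC w hw).2 t
  · refine ae_of_all _ fun t w hw => ?_
    have := ((hasDerivAt_inv_pow_sub t (hC w hw).1 1).sub_const
      ((t : ℂ) / (1 + (t : ℂ) ^ 2))).const_mul (g t : ℂ)
    simpa using this

theorem differentiableOn_cauchyTransform (hg : AEStronglyMeasurable g volume)
    (hb : ∀ᵐ t, |g t| ≤ b) : DifferentiableOn ℂ (cauchyTransform g) upperHalf :=
  fun _ hz => (hasDerivAt_cauchyTransform hg hb hz).differentiableAt.differentiableWithinAt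

theorem iteratedDeriv_cauchyTransform (hg : AEStronglyMeasurable g volume)
    (hb : ∀ᵐ t, |g t| ≤ b) (k : ℕ) : ∀ z : ℂ, 0 < z.im →
    iteratedDeriv (k + 1) (cauchyTransform g) z =
      ((Real.pi : ℂ) * Complex.I)⁻¹ *
        (((k + 1)! : ℂ) * ∫ t : ℝ, (g t : ℂ) * (((t : ℂ) - z) ^ (k + 2))⁻¹) := by
  induction k with
  | zero =>
    intro z hz
    rw [zero_add, iteratedDeriv_one, (hasDerivAt_cauchyTransform hg hb hz).deriv]
    simp
  | succ k ih =>
    intro z hz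
    have hev : iteratedDeriv (k + 1) (cauchyTransform g) =ᶠ[𝓝 z] fun w =>
        ((Real.pi : ℂ) * Complex.I)⁻¹ *
          (((k + 1)! : ℂ) * ∫ t : ℝ, (g t : ℂ) * (((t : ℂ) - w) ^ (k + 2))⁻¹) := by
      filter_upwards [isOpen_upperHalf.mem_nhds hz] with w hw using ih w hw
    rw [iteratedDeriv_succ, hev.deriv_eq,
      (((hasDerivAt_integral_inv_pow hg hb hz k).const_mul _).const_mul _).deriv,
      Nat.factorial_succ (k + 1)]
    push_cast
    ring

/-- The real part of the Cauchy transform is the Poisson integral, written with the kernel at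
the point `i` and the boundary function rescaled. -/
theorem re_cauchyTransform (hg : AEStronglyMeasurable g volume)
    (hb : ∀ᵐ t, |g t| ≤ b) {z : ℂ} (hz : 0 < z.im) :
    (cauchyTransform g z).re =
      Real.pi⁻¹ * ∫ s : ℝ, g (z.re + z.im * s) * (1 + s ^ 2)⁻¹ := by
  have h1 : (cauchyTransform g z).re = Real.pi⁻¹ *
      ∫ t : ℝ, g t * (z.im / ((t - z.re) ^ 2 + z.im ^ 2)) := by
    have hi := integral_im (integrable_mul_cauchyKernel hg hb hz)
    have hr : ∀ w : ℂ, (((Real.pi : ℂ) * Complex.I)⁻¹ * w).re = Real.pi⁻¹ * w.im := by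
      intro w
      rw [mul_inv, Complex.inv_I, mul_assoc, ← Complex.ofReal_inv, Complex.re_ofReal_mul]
      simp
    rw [cauchyTransform, hr]
    congr 1
    refine hi.symm.trans (integral_congr_ae (ae_of_all _ fun t => ?_))
    change ((g t : ℂ) * (((t : ℂ) - z)⁻¹ - (t : ℂ) / (1 + (t : ℂ) ^ 2))).im = _
    have h2 : (t : ℂ) / (1 + (t : ℂ) ^ 2) = ((t / (1 + t ^ 2) : ℝ) : ℂ) := by push_cast; rfl
    rw [Complex.im_ofReal_mul, h2, Complex.sub_im, Complex.ofReal_im, sub_zero, Complex.inv_im]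
    congr 1
    simp [Complex.normSq_apply, sq]
  have h3 : ∀ s : ℝ, g (z.re + z.im * s) * (1 + s ^ 2)⁻¹ = z.im *
      (fun t : ℝ => g (z.re + t) * (z.im / (t ^ 2 + z.im ^ 2))) (z.im * s) := by
    intro s
    have : (1 + s ^ 2) ≠ 0 := by positivity
    have h : ((z.im * s) ^ 2 + z.im ^ 2) = z.im ^ 2 * (1 + s ^ 2) := by ring
    simp only [h]
    field_simp
  rw [h1]
  congr 1
  have h4 := Measure.integral_comp_mul_left
    (fun t : ℝ => g (z.re + t) * (z.im / (t ^ 2 + z.im ^ 2))) z.im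
  rw [integral_congr_ae (ae_of_all _ h3), integral_const_mul, h4,
    abs_of_pos (inv_pos.2 hz), smul_eq_mul,
    ← mul_assoc, mul_inv_cancel₀ hz.ne', one_mul,
    ← integral_add_left_eq_self (fun t => g t * (z.im / ((t - z.re) ^ 2 + z.im ^ 2))) z.re]
  simp

end

/-! ### The Poisson formula on horizontal lines -/

/-- Substitution `θ = arctan s`. -/
theorem integral_comp_arctan {E : Type*} [NormedAddCommGroup E] [NormedSpace ℝ E] (h : ℝ → E) :
    ∫ θ in (-(Real.pi / 2))..(Real.pi / 2), h θ =
      ∫ s : ℝ, (1 + s ^ 2)⁻¹ • h (Real.arctan s) := by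
  have himg : Real.arctan '' univ = Ioo (-(Real.pi / 2)) (Real.pi / 2) := by
    rw [image_univ, Real.range_arctan]
  have h1 := integral_image_eq_integral_abs_deriv_smul (f := Real.arctan)
    (f' := fun s => 1 / (1 + s ^ 2)) MeasurableSet.univ
    (fun x _ => (Real.hasDerivAt_arctan x).hasDerivWithinAt) Real.arctan_injective.injOn h
  rw [himg, Measure.restrict_univ] at h1
  rw [intervalIntegral.integral_of_le (by linarith [Real.pi_pos]), integral_Ioc_eq_integral_Ioo, h1]
  refine integral_congr_ae (ae_of_all _ fun s => ?_)
  have : 0 < 1 / (1 + s ^ 2) := by positivity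
  beta_reduce
  rw [abs_of_pos this, one_div]

theorem integral_comp_tan {E : Type*} [NormedAddCommGroup E] [NormedSpace ℝ E] (h : ℝ → E) :
    ∫ θ in (-(Real.pi / 2))..(Real.pi / 2), h (Real.tan θ) =
      ∫ s : ℝ, (1 + s ^ 2)⁻¹ • h s := by
  rw [integral_comp_arctan (fun θ => h (Real.tan θ))]
  simp_rw [Real.tan_arctan]

theorem integral_comp_tan_half (h : ℝ → ℝ) :
    ∫ θ in (0 : ℝ)..(2 * Real.pi), h (Real.tan (θ / 2)) = 2 * ∫ s : ℝ, (1 + s ^ 2)⁻¹ • h s := by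
  have hp : Function.Periodic (fun θ => h (Real.tan θ)) Real.pi := fun θ => by
    simp only [Real.tan_add_pi]
  rw [intervalIntegral.integral_comp_div (fun θ => h (Real.tan θ)) two_ne_zero, zero_div,
    mul_div_cancel_left₀ _ (two_ne_zero), smul_eq_mul, ← integral_comp_tan]
  have := hp.intervalIntegral_add_eq 0 (-(Real.pi / 2))
  rw [zero_add, show -(Real.pi / 2) + Real.pi = Real.pi / 2 by ring] at this
  rw [this]

/-- The Cayley map `w ↦ i * (1 - w) / (1 + w)` takes the unit disc to the upper half-plane. -/
theorem cayley_im (w : ℂ) :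
    (Complex.I * ((1 - w) / (1 + w))).im = (1 - ‖w‖ ^ 2) / ‖1 + w‖ ^ 2 := by
  rw [← Complex.normSq_eq_norm_sq, ← Complex.normSq_eq_norm_sq, Complex.I_mul_im, Complex.div_re,
    ← add_div]
  congr 1
  simp [Complex.normSq_apply]
  ring

/-- On the unit circle, with the boundary point `-1` removed, the Cayley map is real. -/
theorem cayley_circleMap {θ : ℝ} (h : circleMap 0 1 θ ≠ -1) :
    Complex.I * ((1 - circleMap 0 1 θ) / (1 + circleMap 0 1 θ)) = (Real.tan (θ / 2) : ℂ) := by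
  have h1 : (1 + circleMap 0 1 θ) ≠ 0 := fun h' => h (eq_neg_of_add_eq_zero_right h')
  have hexp : circleMap 0 1 θ = (Complex.cos (θ / 2) + Complex.sin (θ / 2) * Complex.I) ^ 2 := by
    rw [← Complex.exp_mul_I, ← Complex.exp_nat_mul, circleMap]
    simp only [Complex.ofReal_one, zero_add, one_mul]
    congr 1
    push_cast
    ring
  have hsc := Complex.sin_sq_add_cos_sq ((θ : ℂ) / 2)
  have e1 : 1 + circleMap 0 1 θ = 2 * Complex.cos (θ / 2) *
      (Complex.cos (θ / 2) + Complex.sin (θ / 2) * Complex.I) := by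
    rw [hexp]
    linear_combination (Complex.sin (θ / 2) ^ 2) * Complex.I_sq - hsc
  have e2 : Complex.I * (1 - circleMap 0 1 θ) = 2 * Complex.sin (θ / 2) *
      (Complex.cos (θ / 2) + Complex.sin (θ / 2) * Complex.I) := by
    rw [hexp]
    linear_combination (-2 * Complex.cos (θ / 2) * Complex.sin (θ / 2) -
      Complex.sin (θ / 2) ^ 2 * Complex.I) * Complex.I_sq - Complex.I * hsc
  have hc : Complex.cos (θ / 2) ≠ 0 := by
    intro h'; rw [e1, h'] at h1; simp at h1
  have he : Complex.cos (θ / 2) + Complex.sin (θ / 2) * Complex.I ≠ 0 := by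
    intro h'; rw [e1, h'] at h1; simp at h1
  rw [mul_div_assoc', e2, e1, Complex.ofReal_tan]
  push_cast
  rw [Complex.tan_eq_sin_div_cos]
  field_simp

theorem circleMap_ne_neg_one {θ : ℝ} (h0 : 0 < θ) (h1 : θ ≤ 2 * Real.pi) (h2 : θ ≠ Real.pi) :
    circleMap 0 1 θ ≠ -1 := by
  intro h
  have hre : Real.cos θ = -1 := by
    have := congrArg Complex.re h
    simpa [circleMap, Complex.exp_ofReal_mul_I_re] using this
  have h3 : Real.cos (θ - Real.pi) = 1 := by rw [Real.cos_sub_pi, hre]; norm_num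
  rw [Real.cos_eq_one_iff_of_lt_of_lt (by linarith [Real.pi_pos]) (by linarith [Real.pi_pos])] at h3
  exact h2 (by linarith)

/-- The Poisson formula on a horizontal line strictly inside the half-plane. It is the mean value
property, transported by the Cayley map of the unit disc. -/
theorem re_eq_integral_of_differentiableOn {f : ℂ → ℂ} {M : ℝ}
    (hf : DifferentiableOn ℂ f upperHalf) (hM : ∀ w ∈ upperHalf, |(f w).re| ≤ M)
    (x : ℝ) {y ε : ℝ} (hy : 0 < y) (hε : 0 < ε) :
    (f (x + (y + ε : ℝ) * Complex.I)).re =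
      Real.pi⁻¹ * ∫ s : ℝ, (f ((x + y * s : ℝ) + ε * Complex.I)).re * (1 + s ^ 2)⁻¹ := by
  set ψ : ℂ → ℂ := fun w => x + ε * Complex.I + y * (Complex.I * ((1 - w) / (1 + w))) with hψ
  have hψim : ∀ w : ℂ, ‖w‖ ≤ 1 → ψ w ∈ upperHalf := by
    intro w hw
    have h1 : (ψ w).im = ε + y * ((1 - ‖w‖ ^ 2) / ‖1 + w‖ ^ 2) := by
      rw [← cayley_im]
      simp [hψ, -Complex.mul_im, Complex.im_ofReal_mul]
    have h2 : 0 ≤ (1 - ‖w‖ ^ 2) / ‖1 + w‖ ^ 2 :=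
      div_nonneg (by nlinarith [norm_nonneg w]) (by positivity)
    change 0 < (ψ w).im
    rw [h1]
    positivity
  have hψd : ∀ w : ℂ, 1 + w ≠ 0 → DifferentiableAt ℂ ψ w := by
    intro w hw
    have : DifferentiableAt ℂ (fun w : ℂ => (1 - w) / (1 + w)) w :=
      DifferentiableAt.div (by fun_prop) (by fun_prop) hw
    exact ((this.const_mul Complex.I).const_mul (y : ℂ)).const_add _
  have hFd : ∀ w : ℂ, ‖w‖ ≤ 1 → 1 + w ≠ 0 → DifferentiableAt ℂ (f ∘ ψ) w := fun w hw hw' =>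
    (hf.differentiableAt (isOpen_upperHalf.mem_nhds (hψim w hw))).comp w (hψd w hw')
  have hne : ∀ w : ℂ, ‖w‖ < 1 → 1 + w ≠ 0 := by
    intro w hw h
    rw [eq_neg_of_add_eq_zero_right h] at hw
    simp at hw
  have hnorm : ∀ r : ℝ, 0 ≤ r → ∀ θ, ‖circleMap 0 r θ‖ = r := fun r hr θ => by
    simp [abs_of_nonneg hr]
  -- the mean value property on the circle of radius `r < 1`
  have hmean : ∀ r ∈ Ioo (0 : ℝ) 1,
      ∫ θ in (0 : ℝ)..(2 * Real.pi), (f (ψ (circleMap 0 r θ))).re =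
        2 * Real.pi * (f (ψ 0)).re := by
    intro r hr
    have hd : DiffContOnCl ℂ (f ∘ ψ) (Metric.ball 0 |r|) := by
      refine DifferentiableOn.diffContOnCl fun w hw => ?_
      have hw' : ‖w‖ < 1 := by
        have := Metric.closure_ball_subset_closedBall hw
        rw [mem_closedBall_zero_iff, abs_of_pos hr.1] at this
        linarith [hr.2]
      exact (hFd w hw'.le (hne w hw')).differentiableWithinAt
    have h := hd.circleAverage
    have hci : IntervalIntegrable (fun θ => (f ∘ ψ) (circleMap 0 r θ)) volume 0
        (2 * Real.pi) := by
      refine Continuous.intervalIntegrable ?_ _ _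
      rw [continuous_iff_continuousAt]
      intro θ
      have hw' : ‖circleMap 0 r θ‖ < 1 := by rw [hnorm r hr.1.le]; exact hr.2
      exact (hFd _ hw'.le (hne _ hw')).continuousAt.comp (f := circleMap 0 r)
        (continuous_circleMap 0 r).continuousAt
    have h' := congrArg Complex.re h
    have hcomm := Complex.reCLM.intervalIntegral_comp_comm hci
    simp only [Complex.reCLM_apply, Function.comp_apply] at hcomm
    rw [Real.circleAverage_def, Complex.smul_re, smul_eq_mul] at h'
    simp only [Function.comp_apply] at h'
    rw [hcomm, ← h', mul_inv_cancel_left₀ (by positivity)]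
  have hae : ∀ᵐ θ : ℝ, θ ∈ uIoc (0 : ℝ) (2 * Real.pi) → circleMap 0 1 θ ≠ -1 := by
    -- `θ = π` is the point sent to infinity
    filter_upwards [Measure.ae_ne volume Real.pi] with θ hθ hmem
    rw [uIoc_of_le (by positivity)] at hmem
    exact circleMap_ne_neg_one hmem.1 hmem.2 hθ
  have hlim : Tendsto (fun r : ℝ => ∫ θ in (0 : ℝ)..(2 * Real.pi),
      (f (ψ (circleMap 0 r θ))).re) (𝓝[<] 1)
      (𝓝 (∫ θ in (0 : ℝ)..(2 * Real.pi), (f (ψ (circleMap 0 1 θ))).re)) := by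
    have hIoo : ∀ᶠ r : ℝ in 𝓝[<] 1, r ∈ Ioo (0 : ℝ) 1 := Ioo_mem_nhdsLT zero_lt_one
    refine intervalIntegral.tendsto_integral_filter_of_dominated_convergence (fun _ => M) ?_ ?_
      intervalIntegrable_const ?_
    · filter_upwards [hIoo] with r hr
      refine Continuous.aestronglyMeasurable ?_
      rw [continuous_iff_continuousAt]
      intro θ
      have hw' : ‖circleMap 0 r θ‖ < 1 := by rw [hnorm r hr.1.le]; exact hr.2
      exact Complex.continuous_re.continuousAt.comp <|
        (hFd _ hw'.le (hne _ hw')).continuousAt.comp (f := circleMap 0 r)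
        (continuous_circleMap 0 r).continuousAt
    · filter_upwards [hIoo] with r hr
      refine ae_of_all _ fun θ _ => ?_
      exact hM _ (hψim _ (by rw [hnorm r hr.1.le]; exact hr.2.le))
    · filter_upwards [hae] with θ hθ hmem
      have h1 : 1 + circleMap 0 1 θ ≠ 0 := fun h' => hθ hmem (eq_neg_of_add_eq_zero_right h')
      have hc : ContinuousAt (fun r : ℝ => circleMap 0 r θ) 1 := by
        unfold circleMap; fun_prop
      have := (hFd _ (hnorm 1 zero_le_one θ).le h1).continuousAt.comp_of_eq hc rfl
      exact ((Complex.continuous_re.continuousAt.comp this).tendsto).mono_left nhdsWithin_le_nhds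
  have hconst : Tendsto (fun r : ℝ => ∫ θ in (0 : ℝ)..(2 * Real.pi),
      (f (ψ (circleMap 0 r θ))).re) (𝓝[<] 1) (𝓝 (2 * Real.pi * (f (ψ 0)).re)) := by
    refine tendsto_const_nhds.congr' ?_
    filter_upwards [Ioo_mem_nhdsLT zero_lt_one] with r hr using (hmean r hr).symm
  have h0 := tendsto_nhds_unique hlim hconst
  have hint : ∫ θ in (0 : ℝ)..(2 * Real.pi), (f (ψ (circleMap 0 1 θ))).re =
      ∫ θ in (0 : ℝ)..(2 * Real.pi),
        (fun s : ℝ => (f ((x + y * s : ℝ) + ε * Complex.I)).re) (Real.tan (θ / 2)) := by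
    refine intervalIntegral.integral_congr_ae ?_
    filter_upwards [hae] with θ hθ hmem
    simp only [hψ]
    rw [cayley_circleMap (hθ hmem)]
    congr 2
    push_cast
    ring
  have hψ0 : ψ 0 = x + (y + ε : ℝ) * Complex.I := by simp [hψ]; ring
  rw [hint, integral_comp_tan_half
    (fun s : ℝ => (f ((x + y * s : ℝ) + ε * Complex.I)).re), hψ0] at h0
  have h1 : (f (x + (y + ε : ℝ) * Complex.I)).re = Real.pi⁻¹ *
      ∫ s : ℝ, (1 + s ^ 2)⁻¹ • (f ((x + y * s : ℝ) + ε * Complex.I)).re := by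
    rw [eq_inv_mul_iff_mul_eq₀ Real.pi_ne_zero]
    linarith
  rw [h1]
  congr 2
  ext s
  rw [smul_eq_mul, mul_comm]

/-! ### Vertical boundary limits -/

/-- Arzelà–Ascoli for functions on the line with a common Lipschitz constant. -/
theorem exists_subseq_tendsto_of_lipschitzWith {M : NNReal} {U : ℕ → ℝ → ℝ}
    (hU : ∀ n, LipschitzWith M (U n)) (h0 : ∀ n, U n 0 = 0) :
    ∃ (V : ℝ → ℝ) (k : ℕ → ℕ), StrictMono k ∧ LipschitzWith M V ∧
      ∀ x, Tendsto (fun n => U (k n) x) atTop (𝓝 (V x)) := by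
  let S : Set C(ℝ, ℝ) := {g | LipschitzWith M g ∧ g 0 = 0}
  have hcpt : IsCompact S := by
    refine ArzelaAscoli.isCompact_of_equicontinuous S ?_ ?_
    · have himg : ContinuousMap.toFun '' S = {g : ℝ → ℝ | LipschitzWith M g ∧ g 0 = 0} := by
        ext g
        constructor
        · rintro ⟨g', hg', rfl⟩
          exact hg'
        · intro hg
          exact ⟨⟨g, hg.1.continuous⟩, hg, rfl⟩
      rw [himg]
      refine (isCompact_univ_pi (s := fun x : ℝ => Metric.closedBall (0 : ℝ) (M * |x|))
        fun x => isCompact_closedBall _ _).of_isClosed_subset ?_ ?_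
      · have : {g : ℝ → ℝ | LipschitzWith M g ∧ g 0 = 0} =
            (⋂ x, ⋂ y, {g : ℝ → ℝ | dist (g x) (g y) ≤ M * dist x y}) ∩ {g | g 0 = 0} := by
          ext g
          simp [lipschitzWith_iff_dist_le_mul]
        rw [this]
        refine IsClosed.inter (isClosed_iInter fun x => isClosed_iInter fun y =>
          isClosed_le (by fun_prop) continuous_const) (isClosed_eq (by fun_prop) continuous_const)
      · intro g hg x _
        have := hg.1.dist_le_mul x 0
        rw [hg.2] at this
        simpa [Real.dist_eq] using this
    · refine Metric.equicontinuous_of_continuity_modulus (fun d => M * d) ?_ _ ?_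
      · have : Tendsto (fun d : ℝ => (M : ℝ) * d) (𝓝 0) (𝓝 (M * 0)) := by
          exact (continuous_const.mul continuous_id).tendsto 0
        simpa using this
      · intro x y g
        exact g.2.1.dist_le_mul x y
  obtain ⟨V, hV, k, hk, hlim⟩ := hcpt.tendsto_subseq (x := fun n => ⟨U n, (hU n).continuous⟩)
    fun n => ⟨hU n, h0 n⟩
  refine ⟨V, k, hk, hV.1, fun x => ?_⟩
  exact ((continuous_eval_const (F := C(ℝ, ℝ)) x).tendsto V).comp hlim

theorem abs_two_mul_div_one_add_sq_le (s : ℝ) :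
    |s * (2 * s / (1 + s ^ 2) ^ 2)| ≤ 2 * (1 + s ^ 2)⁻¹ := by
  have h : 0 < 1 + s ^ 2 := by positivity
  have h1 : s * (2 * s / (1 + s ^ 2) ^ 2) = 2 * (s ^ 2 / (1 + s ^ 2)) * (1 + s ^ 2)⁻¹ := by
    field_simp
  rw [h1, abs_of_nonneg (by positivity)]
  gcongr
  have : s ^ 2 / (1 + s ^ 2) ≤ 1 := by rw [div_le_one h]; linarith
  linarith

theorem abs_mul_kernel_le {M v s : ℝ} (hM : 0 ≤ M) (h : |v| ≤ M * |s|) :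
    |v * (2 * s / (1 + s ^ 2) ^ 2)| ≤ M * (2 * (1 + s ^ 2)⁻¹) := by
  calc |v * (2 * s / (1 + s ^ 2) ^ 2)| ≤ (M * |s|) * |2 * s / (1 + s ^ 2) ^ 2| := by
        rw [abs_mul]; gcongr
    _ = M * |s * (2 * s / (1 + s ^ 2) ^ 2)| := by rw [abs_mul]; ring
    _ ≤ _ := by gcongr; exact abs_two_mul_div_one_add_sq_le s

theorem integrable_kernel_bound (M : ℝ) : Integrable fun s : ℝ => M * (2 * (1 + s ^ 2)⁻¹) :=
  (integrable_inv_one_add_sq.const_mul 2).const_mul M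

theorem continuous_poissonKernel_deriv : Continuous fun s : ℝ => 2 * s / (1 + s ^ 2) ^ 2 :=
  Continuous.div (by fun_prop) (by fun_prop) fun s => by positivity

/-- The Poisson integral of a bounded function in terms of a Lipschitz primitive. -/
theorem integral_mul_inv_one_add_sq_eq {h V : ℝ → ℝ} {M : ℝ} (hM : 0 ≤ M) (hc : Continuous h)
    (hb : ∀ s, |h s| ≤ M) (hV : ∀ s, HasDerivAt V (h s) s) (hVb : ∀ s, |V s| ≤ M * |s|) :
    ∫ s : ℝ, h s * (1 + s ^ 2)⁻¹ = ∫ s : ℝ, V s * (2 * s / (1 + s ^ 2) ^ 2) := by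
  have hVc : Continuous V := continuous_iff_continuousAt.2 fun s => (hV s).continuousAt
  have hker : Continuous fun s : ℝ => (1 + s ^ 2)⁻¹ :=
    Continuous.inv₀ (by fun_prop) fun s => by positivity
  have hd : ∀ s : ℝ, HasDerivAt (fun s : ℝ => (1 + s ^ 2)⁻¹) (-(2 * s / (1 + s ^ 2) ^ 2)) s := by
    intro s
    have := (((hasDerivAt_id s).pow 2).const_add 1).inv (by simp only [id, Pi.pow_apply]; positivity)
    refine this.congr_deriv ?_
    simp [neg_div]
  have hlim : ∀ l : Filter ℝ, Tendsto (fun s : ℝ => |s|) l atTop →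
      Tendsto ((fun s : ℝ => (1 + s ^ 2)⁻¹) * V) l (𝓝 0) := by
    intro l hl
    have h1 : Tendsto (fun s : ℝ => M * |s|⁻¹) l (𝓝 0) := by
      simpa using (tendsto_inv_atTop_zero.comp hl).const_mul M
    refine squeeze_zero_norm (fun s => ?_) h1
    rw [Pi.mul_apply, norm_mul, Real.norm_eq_abs, Real.norm_eq_abs,
      abs_of_pos (by positivity : 0 < (1 + s ^ 2)⁻¹)]
    rcases eq_or_ne s 0 with rfl | hs
    · have := hVb 0
      simpa using this
    · have hs' : 0 < |s| := abs_pos.2 hs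
      calc (1 + s ^ 2)⁻¹ * |V s| ≤ (s ^ 2)⁻¹ * (M * |s|) := by
            gcongr
            · linarith
            · exact hVb s
        _ = M * |s|⁻¹ := by
            rw [← sq_abs s]; field_simp
  have hi1 : Integrable ((fun s : ℝ => (1 + s ^ 2)⁻¹) * h) := by
    refine (integrable_const_div_one_add_sq M).mono' (hker.mul hc).aestronglyMeasurable ?_
    refine ae_of_all _ fun s => ?_
    rw [Pi.mul_apply, norm_mul, Real.norm_eq_abs, Real.norm_eq_abs,
      abs_of_pos (by positivity : 0 < (1 + s ^ 2)⁻¹), mul_comm]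
    gcongr
    exact hb s
  have hi2 : Integrable ((fun s : ℝ => -(2 * s / (1 + s ^ 2) ^ 2)) * V) := by
    refine (integrable_kernel_bound M).mono'
      (continuous_poissonKernel_deriv.neg.mul hVc).aestronglyMeasurable ?_
    refine ae_of_all _ fun s => ?_
    rw [Pi.mul_apply, neg_mul, norm_neg, mul_comm, Real.norm_eq_abs]
    exact abs_mul_kernel_le hM (hVb s)
  have key := integral_mul_deriv_eq_deriv_mul (fun s _ => hd s) (fun s _ => hV s) hi1 hi2
    (hlim _ tendsto_abs_atBot_atTop) (hlim _ tendsto_abs_atTop_atTop)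
  calc ∫ s : ℝ, h s * (1 + s ^ 2)⁻¹ = ∫ s : ℝ, (1 + s ^ 2)⁻¹ * h s := by simp_rw [mul_comm]
    _ = _ := by
      rw [key, sub_self, zero_sub, ← integral_neg]
      congr 1
      ext s
      ring

section

variable {f : ℂ → ℂ} {M : ℝ}

theorem continuous_re_on_line (hf : DifferentiableOn ℂ f upperHalf) {ε : ℝ} (hε : 0 < ε) :
    Continuous fun t : ℝ => (f ((t : ℂ) + ε * Complex.I)).re := by
  refine Complex.continuous_re.comp (hf.continuousOn.comp_continuous (by fun_prop) fun t => ?_)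
  simpa [upperHalf] using hε

theorem add_mul_I_mem_upperHalf (x : ℝ) {y : ℝ} (hy : 0 < y) :
    (x : ℂ) + (y : ℂ) * Complex.I ∈ upperHalf := by
  simpa [upperHalf] using hy

theorem tendsto_re_add_inv (hf : DifferentiableOn ℂ f upperHalf) (x : ℝ) {y : ℝ} (hy : 0 < y)
    {a : ℕ → ℝ} (ha : Tendsto a atTop (𝓝 0)) :
    Tendsto (fun n : ℕ => (f (x + (y + a n : ℝ) * Complex.I)).re) atTop
      (𝓝 (f (x + y * Complex.I)).re) := by
  have h1 : ContinuousAt f (x + y * Complex.I) :=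
    (hf.differentiableAt (isOpen_upperHalf.mem_nhds (add_mul_I_mem_upperHalf x hy))).continuousAt
  have h2 : Tendsto (fun n : ℕ => (x : ℂ) + (y + a n : ℝ) * Complex.I) atTop
      (𝓝 (x + y * Complex.I)) := by
    have h3 : Tendsto (fun n => y + a n) atTop (𝓝 y) := by simpa using ha.const_add y
    exact (((Complex.continuous_ofReal.tendsto y).comp h3).mul_const _).const_add _
  exact (Complex.continuous_re.tendsto _).comp (h1.tendsto.comp h2)

/-- A bounded real part of a holomorphic function is a Poisson integral, in the weak sense that it
is represented by a Lipschitz function `V` which plays the role of the primitive of its boundary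
values. The function `V` is a limit of primitives along horizontal lines. -/
theorem exists_lipschitz_primitive (hf : DifferentiableOn ℂ f upperHalf)
    (hM : ∀ w ∈ upperHalf, |(f w).re| ≤ M) :
    ∃ V : ℝ → ℝ, LipschitzWith M.toNNReal V ∧ ∀ (x : ℝ) {y : ℝ}, 0 < y →
      (f (x + y * Complex.I)).re = Real.pi⁻¹ *
        ∫ s : ℝ, (y⁻¹ * (V (x + y * s) - V x)) * (2 * s / (1 + s ^ 2) ^ 2) := by
  have hM0 : 0 ≤ M := (abs_nonneg _).trans (hM Complex.I (by simp [upperHalf]))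
  have hcoe : (M.toNNReal : ℝ) = M := Real.coe_toNNReal M hM0
  set a : ℕ → ℝ := fun n => 1 / ((n : ℝ) + 1) with ha
  have hapos : ∀ n, 0 < a n := fun n => Nat.one_div_pos_of_nat
  have halim : Tendsto a atTop (𝓝 0) := tendsto_one_div_add_atTop_nhds_zero_nat
  set u : ℕ → ℝ → ℝ := fun n t => (f ((t : ℂ) + a n * Complex.I)).re with hu
  have huc : ∀ n, Continuous (u n) := fun n => continuous_re_on_line hf (hapos n)
  have hub : ∀ n t, |u n t| ≤ M := fun n t => hM _ (add_mul_I_mem_upperHalf t (hapos n))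
  set U : ℕ → ℝ → ℝ := fun n x => ∫ t in (0 : ℝ)..x, u n t with hUdef
  have hUd : ∀ n x, HasDerivAt (U n) (u n x) x := fun n x =>
    intervalIntegral.integral_hasDerivAt_right ((huc n).intervalIntegrable _ _)
      (huc n).aestronglyMeasurable.stronglyMeasurableAtFilter (huc n).continuousAt
  have hUL : ∀ n, LipschitzWith M.toNNReal (U n) := by
    intro n
    refine lipschitzWith_of_nnnorm_deriv_le (fun x => (hUd n x).differentiableAt) fun x => ?_
    rw [(hUd n x).deriv, ← NNReal.coe_le_coe, coe_nnnorm, hcoe]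
    exact hub n x
  obtain ⟨V, k, hk, hV, hlim⟩ := exists_subseq_tendsto_of_lipschitzWith hUL
    (fun n => by simp [hUdef])
  refine ⟨V, hV, fun x y hy => ?_⟩
  have hbound : ∀ {W : ℝ → ℝ}, LipschitzWith M.toNNReal W → ∀ s : ℝ,
      |y⁻¹ * (W (x + y * s) - W x)| ≤ M * |s| := by
    intro W hW s
    have := hW.dist_le_mul (x + y * s) x
    rw [Real.dist_eq, Real.dist_eq, hcoe, add_sub_cancel_left, abs_mul, abs_of_pos hy] at this
    rw [abs_mul, abs_of_pos (inv_pos.2 hy), inv_mul_le_iff₀ hy]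
    linarith
  have hrep : ∀ n, (f (x + (y + a n : ℝ) * Complex.I)).re = Real.pi⁻¹ *
      ∫ s : ℝ, (y⁻¹ * (U n (x + y * s) - U n x)) * (2 * s / (1 + s ^ 2) ^ 2) := by
    intro n
    rw [re_eq_integral_of_differentiableOn hf hM x hy (hapos n)]
    congr 1
    refine integral_mul_inv_one_add_sq_eq (h := fun s => u n (x + y * s)) hM0
      ((huc n).comp (by fun_prop)) (fun s => hub n _) (fun s => ?_) (hbound (hUL n))
    have h1 : HasDerivAt (fun s : ℝ => x + y * s) y s := by
      simpa using ((hasDerivAt_id s).const_mul y).const_add x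
    have h2 := (((hUd n (x + y * s)).comp s h1).sub_const (U n x)).const_mul y⁻¹
    refine h2.congr_deriv ?_
    field_simp
  have hleft := tendsto_re_add_inv hf x hy (halim.comp hk.tendsto_atTop)
  have hright : Tendsto (fun n => ∫ s : ℝ, (y⁻¹ * (U (k n) (x + y * s) - U (k n) x)) *
      (2 * s / (1 + s ^ 2) ^ 2)) atTop
      (𝓝 (∫ s : ℝ, (y⁻¹ * (V (x + y * s) - V x)) * (2 * s / (1 + s ^ 2) ^ 2))) := by
    refine tendsto_integral_of_dominated_convergence (fun s => M * (2 * (1 + s ^ 2)⁻¹))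
      (fun n => ?_) (integrable_kernel_bound M) (fun n => ae_of_all _ fun s => ?_)
      (ae_of_all _ fun s => ?_)
    · have := (hUL (k n)).continuous
      exact (Continuous.mul (by fun_prop) continuous_poissonKernel_deriv).aestronglyMeasurable
    · exact abs_mul_kernel_le hM0 (hbound (hUL (k n)) s)
    · exact (((hlim _).sub (hlim _)).const_mul _).mul_const _
  refine tendsto_nhds_unique hleft ?_
  simp only [Function.comp_apply]
  simp_rw [hrep]
  exact hright.const_mul _

/-- **Fatou's theorem** for vertical limits: they exist at each point of differentiability of the
primitive of the boundary values. -/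
theorem ae_exists_tendsto_re (hf : DifferentiableOn ℂ f upperHalf)
    (hM : ∀ w ∈ upperHalf, |(f w).re| ≤ M) :
    ∀ᵐ x : ℝ, ∃ L : ℝ, Tendsto (fun y : ℝ => (f (x + y * Complex.I)).re) (𝓝[>] 0) (𝓝 L) := by
  have hM0 : 0 ≤ M := (abs_nonneg _).trans (hM Complex.I (by simp [upperHalf]))
  have hcoe : (M.toNNReal : ℝ) = M := Real.coe_toNNReal M hM0
  obtain ⟨V, hV, hrep⟩ := exists_lipschitz_primitive hf hM
  filter_upwards [hV.ae_differentiableAt_real] with x hx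
  refine ⟨Real.pi⁻¹ * ∫ s : ℝ, (deriv V x * s) * (2 * s / (1 + s ^ 2) ^ 2), ?_⟩
  have hlim : Tendsto (fun y : ℝ => ∫ s : ℝ, (y⁻¹ * (V (x + y * s) - V x)) *
      (2 * s / (1 + s ^ 2) ^ 2)) (𝓝[>] 0)
      (𝓝 (∫ s : ℝ, (deriv V x * s) * (2 * s / (1 + s ^ 2) ^ 2))) := by
    have hcont := hV.continuous
    refine tendsto_integral_filter_of_dominated_convergence (fun s => M * (2 * (1 + s ^ 2)⁻¹))
      ?_ ?_ (integrable_kernel_bound M) (ae_of_all _ fun s => ?_)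
    · refine Eventually.of_forall fun y => ?_
      exact (Continuous.mul (by fun_prop) continuous_poissonKernel_deriv).aestronglyMeasurable
    · filter_upwards [self_mem_nhdsWithin] with y (hy : 0 < y)
      refine ae_of_all _ fun s => abs_mul_kernel_le hM0 ?_
      have := hV.dist_le_mul (x + y * s) x
      rw [Real.dist_eq, Real.dist_eq, hcoe, add_sub_cancel_left, abs_mul, abs_of_pos hy] at this
      rw [abs_mul, abs_of_pos (inv_pos.2 hy), inv_mul_le_iff₀ hy]
      linarith
    · refine Tendsto.mul_const _ ?_
      have h1 : HasDerivAt (fun y : ℝ => x + y * s) s 0 := by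
        simpa using ((hasDerivAt_id (0 : ℝ)).mul_const s).const_add x
      have h2 : HasDerivAt (fun y : ℝ => V (x + y * s)) (deriv V x * s) 0 :=
        HasDerivAt.comp_of_eq (h₂ := V) 0 hx.hasDerivAt h1 (by simp)
      have h3 := hasDerivAt_iff_tendsto_slope_zero.1 h2
      have h4 : 𝓝[>] (0 : ℝ) ≤ 𝓝[≠] 0 := nhdsWithin_mono _ fun y hy => (ne_of_gt hy)
      refine (h3.mono_left h4).congr fun y => ?_
      simp
  refine (hlim.const_mul Real.pi⁻¹).congr' ?_
  filter_upwards [self_mem_nhdsWithin] with y (hy : 0 < y) using (hrep x hy).symm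

end

/-! ### The boundary trace and the integral representation -/

section

variable {f : ℂ → ℂ} {M : ℝ}

theorem ae_tendsto_boundaryTrace (hf : DifferentiableOn ℂ f upperHalf)
    (hM : ∀ w ∈ upperHalf, |(f w).re| ≤ M) :
    ∀ᵐ x : ℝ, Tendsto (fun y : ℝ => (f ((x : ℂ) + (y : ℂ) * Complex.I)).re) (𝓝[>] (0 : ℝ))
      (𝓝 (boundaryTrace (fun w : ℂ => (f w).re) x)) := by
  filter_upwards [ae_exists_tendsto_re hf hM] with x ⟨L, hL⟩
  have : boundaryTrace (fun w : ℂ => (f w).re) x = L := hL.limUnder_eq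
  rwa [this]

theorem ae_abs_boundaryTrace_le (hf : DifferentiableOn ℂ f upperHalf)
    (hM : ∀ w ∈ upperHalf, |(f w).re| ≤ M) :
    ∀ᵐ x : ℝ, |boundaryTrace (fun w : ℂ => (f w).re) x| ≤ M := by
  filter_upwards [ae_tendsto_boundaryTrace hf hM] with x hx
  refine le_of_tendsto hx.abs ?_
  filter_upwards [self_mem_nhdsWithin] with y (hy : 0 < y)
  exact hM _ (add_mul_I_mem_upperHalf x hy)

theorem tendsto_one_div_add_nhdsGT :
    Tendsto (fun n : ℕ => 1 / ((n : ℝ) + 1)) atTop (𝓝[>] 0) :=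
  tendsto_nhdsWithin_iff.2
    ⟨tendsto_one_div_add_atTop_nhds_zero_nat,
      Eventually.of_forall fun _ => mem_Ioi.2 Nat.one_div_pos_of_nat⟩

theorem aestronglyMeasurable_boundaryTrace (hf : DifferentiableOn ℂ f upperHalf)
    (hM : ∀ w ∈ upperHalf, |(f w).re| ≤ M) :
    AEStronglyMeasurable (boundaryTrace (fun w : ℂ => (f w).re)) volume := by
  refine aestronglyMeasurable_of_tendsto_ae atTop
    (f := fun (n : ℕ) (x : ℝ) => (f ((x : ℂ) + (1 / ((n : ℝ) + 1) : ℝ) * Complex.I)).re)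
    (fun n => (continuous_re_on_line hf Nat.one_div_pos_of_nat).aestronglyMeasurable) ?_
  filter_upwards [ae_tendsto_boundaryTrace hf hM] with x hx
  exact hx.comp tendsto_one_div_add_nhdsGT

theorem memLp_boundaryTrace (hf : DifferentiableOn ℂ f upperHalf)
    (hM : ∀ w ∈ upperHalf, |(f w).re| ≤ M) :
    MemLp (boundaryTrace (fun w : ℂ => (f w).re)) ⊤ (volume : Measure ℝ) :=
  memLp_top_of_bound (aestronglyMeasurable_boundaryTrace hf hM) M
    (ae_abs_boundaryTrace_le hf hM)

theorem boundaryNorm_le {u : ℂ → ℝ} (hM : 0 ≤ M) (h : ∀ᵐ x : ℝ, |boundaryTrace u x| ≤ M) :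
    boundaryNorm u ≤ M := by
  rw [boundaryNorm, eLpNorm_exponent_top]
  exact ENNReal.toReal_le_of_le_ofReal hM (eLpNormEssSup_le_of_ae_bound h)

theorem ae_abs_boundaryTrace_le_boundaryNorm {u : ℂ → ℝ}
    (h : MemLp (boundaryTrace u) ⊤ (volume : Measure ℝ)) :
    ∀ᵐ x : ℝ, |boundaryTrace u x| ≤ boundaryNorm u := by
  filter_upwards [ae_le_eLpNormEssSup (f := boundaryTrace u) (μ := volume)] with x hx
  have htop := h.2.ne
  rw [eLpNorm_exponent_top] at htop
  rw [boundaryNorm, eLpNorm_exponent_top, ← Real.norm_eq_abs, ← toReal_enorm]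
  exact (ENNReal.toReal_le_toReal enorm_ne_top htop).2 hx

/-- The real part of `f` is the Poisson integral of its boundary values. -/
theorem re_eq_re_cauchyTransform_boundaryTrace (hf : DifferentiableOn ℂ f upperHalf)
    (hM : ∀ w ∈ upperHalf, |(f w).re| ≤ M) {z : ℂ} (hz : 0 < z.im) :
    (f z).re = (cauchyTransform (boundaryTrace fun w : ℂ => (f w).re) z).re := by
  set a : ℕ → ℝ := fun n => 1 / ((n : ℝ) + 1) with ha
  have hapos : ∀ n, 0 < a n := fun n => Nat.one_div_pos_of_nat
  set u : ℕ → ℝ → ℝ := fun n t => (f ((t : ℂ) + a n * Complex.I)).re with hu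
  have hum : ∀ n, AEStronglyMeasurable (u n) volume := fun n =>
    (continuous_re_on_line hf (hapos n)).aestronglyMeasurable
  have hub : ∀ n t, |u n t| ≤ M := fun n t => hM _ (add_mul_I_mem_upperHalf t (hapos n))
  have hrep : ∀ n, (f (z.re + (z.im + a n : ℝ) * Complex.I)).re = (cauchyTransform (u n) z).re := by
    intro n
    rw [re_cauchyTransform (hum n) (ae_of_all _ (hub n)) hz,
      re_eq_integral_of_differentiableOn hf hM z.re hz (hapos n)]
  have hleft := tendsto_re_add_inv hf z.re hz tendsto_one_div_add_atTop_nhds_zero_nat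
  rw [Complex.re_add_im] at hleft
  have hM0 : 0 ≤ M := (abs_nonneg _).trans (hub 0 0)
  have hright : Tendsto (fun n => cauchyTransform (u n) z) atTop
      (𝓝 (cauchyTransform (boundaryTrace fun w : ℂ => (f w).re) z)) := by
    refine Tendsto.const_mul _ ?_
    have hone : ∀ᵐ t : ℝ, |(fun _ : ℝ => (1 : ℝ)) t| ≤ 1 := ae_of_all _ fun t => by simp
    refine tendsto_integral_of_dominated_convergence _
      (fun n => aestronglyMeasurable_mul_cauchyKernel (hum n) hz)
      ((integrable_mul_cauchyKernel aestronglyMeasurable_const hone hz).norm.const_mul M)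
      (fun n => ae_of_all _ fun t => ?_) ?_
    · rw [norm_mul, Complex.norm_real, Real.norm_eq_abs]
      simp only [Complex.ofReal_one, one_mul]
      gcongr
      exact hub n t
    · filter_upwards [ae_tendsto_boundaryTrace hf hM] with t ht
      refine Tendsto.mul_const _ ((Complex.continuous_ofReal.tendsto _).comp ?_)
      exact ht.comp tendsto_one_div_add_nhdsGT
  refine tendsto_nhds_unique hleft ?_
  have := (Complex.continuous_re.tendsto _).comp hright
  exact this.congr fun n => (hrep n).symm

/-- `f` and the Cauchy transform of its boundary values have the same real part, hence differ by a
constant, which the derivatives do not see. -/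
theorem iteratedDeriv_eq_integral_boundaryTrace (hf : DifferentiableOn ℂ f upperHalf)
    (hM : ∀ w ∈ upperHalf, |(f w).re| ≤ M) {z : ℂ} (hz : 0 < z.im) (k : ℕ) :
    iteratedDeriv (k + 1) f z = ((Real.pi : ℂ) * Complex.I)⁻¹ * (((k + 1)! : ℂ) *
      ∫ t : ℝ, (boundaryTrace (fun w : ℂ => (f w).re) t : ℂ) * (((t : ℂ) - z) ^ (k + 2))⁻¹) := by
  have hm := aestronglyMeasurable_boundaryTrace hf hM
  have hb := ae_abs_boundaryTrace_le hf hM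
  set g := boundaryTrace fun w : ℂ => (f w).re with hg
  have hd := differentiableOn_cauchyTransform hm hb
  have hconn : IsConnected upperHalf :=
    ⟨⟨Complex.I, by simp [upperHalf]⟩, (convex_halfSpace_im_gt 0).isPreconnected⟩
  obtain ⟨c, hc⟩ := AnalyticOnNhd.eq_const_of_re_eq_const
    (f := fun w => f w - cauchyTransform g w) (c₀ := 0)
    ((hf.sub hd).analyticOnNhd isOpen_upperHalf)
    (fun w hw => by
      rw [Complex.sub_re, re_eq_re_cauchyTransform_boundaryTrace hf hM hw, sub_self])
    isOpen_upperHalf hconn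
  have hev : f =ᶠ[𝓝 z] fun w => c + cauchyTransform g w := by
    filter_upwards [isOpen_upperHalf.mem_nhds hz] with w hw
    rw [← hc w hw]
    ring
  rw [hev.iteratedDeriv_eq, iteratedDeriv_const_add (Nat.succ_pos k),
    iteratedDeriv_cauchyTransform hm hb k z hz]

end

/-! ### The sharp estimate in the half-plane -/

theorem continuous_cosIntegral (s : ℕ) : Continuous (cosIntegral s) := by
  unfold cosIntegral
  exact intervalIntegral.continuous_parametric_intervalIntegral_of_continuous' (by fun_prop) _ _

theorem periodic_cosIntegral (s : ℕ) : Function.Periodic (cosIntegral s) Real.pi := by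
  intro α
  unfold cosIntegral
  congr 1
  ext t
  rw [add_right_comm, Real.cos_add_pi, abs_neg]

theorem isGreatest_sSup_range_cosIntegral (s : ℕ) :
    IsGreatest (range (cosIntegral s)) (sSup (range (cosIntegral s))) :=
  ((periodic_cosIntegral s).compact_of_continuous Real.pi_ne_zero
    (continuous_cosIntegral s)).isGreatest_sSup (range_nonempty _)

theorem cosIntegral_le (s : ℕ) (α : ℝ) : cosIntegral s α ≤ sSup (range (cosIntegral s)) :=
  (isGreatest_sSup_range_cosIntegral s).2 (mem_range_self α)

theorem cosIntegral_nonneg (s : ℕ) (α : ℝ) : 0 ≤ cosIntegral s α := by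
  refine intervalIntegral.integral_nonneg (by linarith [Real.pi_pos]) fun t ht => ?_
  exact mul_nonneg (abs_nonneg _) (pow_nonneg (Real.cos_nonneg_of_mem_Icc ht) _)

theorem realPartConst_nonneg (s : ℕ) : 0 ≤ realPartConst s :=
  mul_nonneg (by positivity) ((cosIntegral_nonneg s 0).trans (cosIntegral_le s 0))

/-- With `t = x + y * tan θ` one has `(t - z)⁻¹ = i * cos θ * exp (-i * θ) / y`, which turns the
`L¹` norm of a projection of the kernel into `cosIntegral`. -/
theorem integral_abs_re_kernel (β : ℝ) {z : ℂ} (hz : 0 < z.im) (k : ℕ) :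
    ∫ t : ℝ, |(Complex.exp (β * Complex.I) * (((t : ℂ) - z) ^ (k + 2))⁻¹).re| =
      (z.im ^ (k + 1))⁻¹ * cosIntegral (k + 1) (-β - (k + 2) * (Real.pi / 2)) := by
  set F : ℝ → ℝ := fun t => |(Complex.exp (β * Complex.I) * (((t : ℂ) - z) ^ (k + 2))⁻¹).re|
  have h1 : ∫ t : ℝ, F t = z.im * ∫ s : ℝ, F (z.re + z.im * s) := by
    have h := Measure.integral_comp_mul_left (fun t => F (z.re + t)) z.im
    rw [integral_add_left_eq_self F z.re, abs_of_pos (inv_pos.2 hz), smul_eq_mul] at h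
    rw [h, mul_inv_cancel_left₀ hz.ne']
  have h2 : ∫ s : ℝ, F (z.re + z.im * s) =
      ∫ θ in (-(Real.pi / 2))..(Real.pi / 2),
        (1 + Real.tan θ ^ 2) * F (z.re + z.im * Real.tan θ) := by
    rw [integral_comp_tan (fun s => (1 + s ^ 2) * F (z.re + z.im * s))]
    congr 1
    ext s
    have : (1 + s ^ 2) ≠ 0 := by positivity
    rw [smul_eq_mul, inv_mul_cancel_left₀ this]
  rw [h1, h2, cosIntegral, ← intervalIntegral.integral_const_mul,
    ← intervalIntegral.integral_const_mul]
  have hle : -(Real.pi / 2) ≤ Real.pi / 2 := by linarith [Real.pi_pos]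
  rw [intervalIntegral.integral_of_le hle, intervalIntegral.integral_of_le hle,
    integral_Ioc_eq_integral_Ioo, integral_Ioc_eq_integral_Ioo]
  refine setIntegral_congr_fun measurableSet_Ioo fun θ hθ => ?_
  have hcos : 0 < Real.cos θ := Real.cos_pos_of_mem_Ioo hθ
  have hcosC : (Real.cos θ : ℂ) ≠ 0 := by exact_mod_cast hcos.ne'
  have hyC : (z.im : ℂ) ≠ 0 := by exact_mod_cast hz.ne'
  have hsub : (((z.re + z.im * Real.tan θ : ℝ) : ℂ) - z)⁻¹ =
      (Real.cos θ / z.im : ℝ) * Complex.exp ((Real.pi / 2 - θ : ℝ) * Complex.I) := by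
    have he : Complex.exp ((Real.pi / 2 - θ : ℝ) * Complex.I) =
        Complex.I * (Complex.exp (θ * Complex.I))⁻¹ := by
      rw [← Complex.exp_neg]
      nth_rewrite 2 [← Complex.exp_pi_div_two_mul_I]
      rw [← Complex.exp_add]
      congr 1
      push_cast
      ring
    have hz' : ((z.re + z.im * Real.tan θ : ℝ) : ℂ) - z =
        z.im * (Real.cos θ : ℂ)⁻¹ * (Complex.exp (θ * Complex.I) * Complex.I⁻¹) := by
      rw [Complex.exp_mul_I, Real.tan_eq_sin_div_cos, Complex.inv_I]
      nth_rewrite 3 [← Complex.re_add_im z]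
      push_cast at hcosC ⊢
      field_simp
      linear_combination (z.im * Complex.sin θ) * Complex.I_sq
    rw [hz', he]
    push_cast
    simp only [mul_inv, inv_inv]
    field_simp
  have hker : (Complex.exp (β * Complex.I) *
      ((((z.re + z.im * Real.tan θ : ℝ) : ℂ) - z) ^ (k + 2))⁻¹).re =
      (Real.cos θ / z.im) ^ (k + 2) *
        Real.cos (-β - (k + 2) * (Real.pi / 2) + ((k + 1 : ℕ) + 1 : ℝ) * θ) := by
    rw [← inv_pow, hsub, mul_pow, ← Complex.exp_nat_mul, mul_left_comm, ← Complex.exp_add,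
      ← Complex.ofReal_pow, Complex.re_ofReal_mul]
    congr 1
    rw [← Real.cos_neg, ← Complex.exp_ofReal_mul_I_re]
    congr 2
    push_cast
    ring
  change z.im * ((1 + Real.tan θ ^ 2) * |_|) = _
  rw [hker, abs_mul, abs_of_pos (by positivity), ← inv_inv (1 + Real.tan θ ^ 2),
    Real.inv_one_add_tan_sq hcos.ne', Nat.add_sub_cancel]
  generalize |Real.cos (-β - (k + 2) * (Real.pi / 2) + ((k + 1 : ℕ) + 1 : ℝ) * θ)| = c
  rw [div_pow]
  field_simp
  ring

section

variable {g : ℝ → ℝ} {b : ℝ}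

theorem integrable_abs_re_kernel (β : ℝ) {z : ℂ} (hz : 0 < z.im) (k : ℕ) :
    Integrable fun t : ℝ => |(Complex.exp (β * Complex.I) * (((t : ℂ) - z) ^ (k + 2))⁻¹).re| := by
  have hone : ∀ᵐ t : ℝ, |(fun _ : ℝ => (1 : ℝ)) t| ≤ 1 := ae_of_all _ fun t => by simp
  have := integrable_mul_inv_pow aestronglyMeasurable_const hone hz k
  simp only [Complex.ofReal_one, one_mul] at this
  exact (this.const_mul _).re.abs

theorem re_exp_mul_integral (hg : AEStronglyMeasurable g volume) (hb : ∀ᵐ t, |g t| ≤ b) (β : ℝ)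
    {z : ℂ} (hz : 0 < z.im) (k : ℕ) :
    (Complex.exp (β * Complex.I) * ∫ t : ℝ, (g t : ℂ) * (((t : ℂ) - z) ^ (k + 2))⁻¹).re =
      ∫ t : ℝ, g t * (Complex.exp (β * Complex.I) * (((t : ℂ) - z) ^ (k + 2))⁻¹).re := by
  have hi := integrable_mul_inv_pow hg hb hz k
  rw [← integral_const_mul]
  refine (integral_re (hi.const_mul _)).symm.trans ?_
  congr 1
  ext t
  rw [← Complex.re_ofReal_mul, mul_left_comm]
  rfl

theorem norm_integral_le_cosIntegral (hg : AEStronglyMeasurable g volume)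
    (hb : ∀ᵐ t, |g t| ≤ b) {z : ℂ} (hz : 0 < z.im) (k : ℕ) :
    ‖∫ t : ℝ, (g t : ℂ) * (((t : ℂ) - z) ^ (k + 2))⁻¹‖ ≤
      b * ((z.im ^ (k + 1))⁻¹ * sSup (range (cosIntegral (k + 1)))) := by
  have hb0 : 0 ≤ b := by
    obtain ⟨t, ht⟩ := hb.exists
    exact (abs_nonneg _).trans ht
  set W := ∫ t : ℝ, (g t : ℂ) * (((t : ℂ) - z) ^ (k + 2))⁻¹
  have hnorm : ‖W‖ = (Complex.exp ((-W.arg : ℝ) * Complex.I) * W).re := by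
    nth_rewrite 3 [← Complex.norm_mul_exp_arg_mul_I W]
    rw [mul_left_comm, ← Complex.exp_add]
    simp
  refine (hnorm.trans (re_exp_mul_integral hg hb (-W.arg) hz k)).le.trans ?_
  calc _ ≤ ∫ t : ℝ, b * |(Complex.exp ((-W.arg : ℝ) * Complex.I) *
        (((t : ℂ) - z) ^ (k + 2))⁻¹).re| := by
        refine (Real.le_norm_self _).trans (norm_integral_le_of_norm_le
          ((integrable_abs_re_kernel _ hz k).const_mul b) ?_)
        filter_upwards [hb] with t ht
        rw [norm_mul, Real.norm_eq_abs, Real.norm_eq_abs]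
        gcongr
    _ ≤ _ := by
      rw [integral_const_mul, integral_abs_re_kernel _ hz k]
      gcongr
      exact cosIntegral_le _ _

end

theorem norm_iteratedDeriv_le_boundaryNorm {f : ℂ → ℂ} (hf : HolomorphicBddRe upperHalf f) {z : ℂ}
    (hz : 0 < z.im) {s : ℕ} (hs : 1 ≤ s) :
    ‖iteratedDeriv s f z‖ ≤
      realPartConst s / z.im ^ s * boundaryNorm (fun w : ℂ => (f w).re) := by
  obtain ⟨hd, M, hM⟩ := hf
  have hM' : ∀ w ∈ upperHalf, |(f w).re| ≤ M := fun w hw => hM (mem_image_of_mem _ hw)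
  obtain ⟨k, rfl⟩ := Nat.exists_eq_add_of_le' hs
  rw [iteratedDeriv_eq_integral_boundaryTrace hd hM' hz k]
  have h := norm_integral_le_cosIntegral (aestronglyMeasurable_boundaryTrace hd hM')
    (ae_abs_boundaryTrace_le_boundaryNorm (memLp_boundaryTrace hd hM')) hz k
  rw [norm_mul, norm_mul, norm_inv, norm_mul, Complex.norm_I, mul_one, Complex.norm_real,
    Real.norm_eq_abs, abs_of_pos Real.pi_pos, Complex.norm_natCast]
  refine (mul_le_mul_of_nonneg_left (mul_le_mul_of_nonneg_left h (by positivity))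
    (by positivity)).trans_eq ?_
  rw [realPartConst]
  ring

theorem abs_re_cauchyTransform_le {g : ℝ → ℝ} (hg : AEStronglyMeasurable g volume)
    (hb : ∀ t, |g t| ≤ 1) {z : ℂ} (hz : 0 < z.im) : |(cauchyTransform g z).re| ≤ 1 := by
  rw [re_cauchyTransform hg (ae_of_all _ hb) hz, abs_mul, abs_of_pos (inv_pos.2 Real.pi_pos),
    inv_mul_le_iff₀ Real.pi_pos, mul_one, ← integral_univ_inv_one_add_sq, ← Real.norm_eq_abs]
  refine norm_integral_le_of_norm_le integrable_inv_one_add_sq (ae_of_all _ fun s => ?_)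
  rw [norm_mul, Real.norm_eq_abs, Real.norm_eq_abs,
    abs_of_pos (by positivity : 0 < (1 + s ^ 2)⁻¹)]
  exact mul_le_of_le_one_left (by positivity) (hb _)

theorem boundaryNorm_one : boundaryNorm (fun _ => 1) = 1 := by
  have : boundaryTrace (fun _ => 1) = fun _ => 1 := by
    ext x
    exact tendsto_const_nhds.limUnder_eq
  rw [boundaryNorm, this, eLpNorm_exponent_top, eLpNormEssSup_const _ (NeZero.ne _)]
  simp

/-- Sharpness: the Cauchy transform of the sign of a projection of the kernel is extremal. -/
theorem realPartConst_le_of_bound {s : ℕ} (hs : 1 ≤ s) {C : ℝ}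
    (hC : ∀ f : ℂ → ℂ, HolomorphicBddRe upperHalf f → ∀ z ∈ upperHalf,
      ‖iteratedDeriv s f z‖ ≤ C / z.im ^ s * boundaryNorm (fun w : ℂ => (f w).re)) :
    realPartConst s ≤ C := by
  have hI : (0 : ℝ) < Complex.I.im := by simp
  -- the constant function `1` excludes a negative `C`
  have hC0 : 0 ≤ C := by
    have h := hC (fun _ => 1) ⟨differentiableOn_const 1, 1, by rintro _ ⟨w, -, rfl⟩; simp⟩
      Complex.I hI
    simp only [Complex.one_re, boundaryNorm_one, Complex.I_im, one_pow, div_one, mul_one] at h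
    exact (norm_nonneg _).trans h
  obtain ⟨k, rfl⟩ := Nat.exists_eq_add_of_le' hs
  obtain ⟨α, hα⟩ := (isGreatest_sSup_range_cosIntegral (k + 1)).1
  set β : ℝ := -α - (k + 2) * (Real.pi / 2) with hβ
  set κ : ℝ → ℝ := fun t =>
    (Complex.exp (β * Complex.I) * (((t : ℂ) - Complex.I) ^ (k + 2))⁻¹).re with hκ
  have hκc : Continuous κ := by
    refine Complex.continuous_re.comp (continuous_const.mul (Continuous.inv₀ (by fun_prop) ?_))
    exact fun t => pow_ne_zero _ (ofReal_sub_ne_zero t hI)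
  set g : ℝ → ℝ := fun t => SignType.sign (κ t) with hg
  have hgm : AEStronglyMeasurable g volume := by
    have : g = fun t => if 0 < κ t then 1 else if κ t < 0 then -1 else 0 := by
      ext t
      rw [hg]
      simp only [sign_apply]
      split_ifs <;> simp
    rw [this]
    refine Measurable.aestronglyMeasurable ?_
    exact Measurable.ite (measurableSet_lt measurable_const hκc.measurable) measurable_const
      (Measurable.ite (measurableSet_lt hκc.measurable measurable_const) measurable_const
        measurable_const)
  have hgb : ∀ t, |g t| ≤ 1 := by
    intro t
    rw [hg]
    rcases lt_trichotomy (κ t) 0 with h | h | h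
    · simp [sign_neg h]
    · simp [h]
    · simp [sign_pos h]
  have hbd : ∀ w ∈ upperHalf, |(cauchyTransform g w).re| ≤ 1 := fun w hw =>
    abs_re_cauchyTransform_le hgm hgb hw
  have hd := differentiableOn_cauchyTransform hgm (ae_of_all _ hgb)
  have h := hC (cauchyTransform g) ⟨hd, 1, by rintro _ ⟨w, hw, rfl⟩; exact hbd w hw⟩ Complex.I hI
  have hn := boundaryNorm_le zero_le_one (ae_abs_boundaryTrace_le hd hbd)
  have hint : cosIntegral (k + 1) α ≤
      ‖∫ t : ℝ, (g t : ℂ) * (((t : ℂ) - Complex.I) ^ (k + 2))⁻¹‖ := by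
    have h1 := integral_abs_re_kernel β hI k
    rw [show -β - (k + 2) * (Real.pi / 2) = α by rw [hβ]; ring] at h1
    simp only [Complex.I_im, one_pow, inv_one, one_mul] at h1
    have h2 := re_exp_mul_integral hgm (ae_of_all _ hgb) β hI k
    have h3 : ∀ t, g t * (Complex.exp (β * Complex.I) *
        (((t : ℂ) - Complex.I) ^ (k + 2))⁻¹).re = |(Complex.exp (β * Complex.I) *
        (((t : ℂ) - Complex.I) ^ (k + 2))⁻¹).re| := fun t => sign_mul_self (κ t)
    rw [integral_congr_ae (ae_of_all _ h3), h1] at h2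
    rw [← h2]
    refine (Complex.re_le_norm _).trans ?_
    rw [norm_mul, Complex.norm_exp_ofReal_mul_I, one_mul]
  rw [iteratedDeriv_cauchyTransform hgm (ae_of_all _ hgb) k _ hI, norm_mul, norm_mul, norm_inv,
    norm_mul, Complex.norm_I, mul_one, Complex.norm_real,
    Real.norm_eq_abs, abs_of_pos Real.pi_pos, Complex.norm_natCast, Complex.I_im, one_pow,
    div_one] at h
  calc realPartConst (k + 1) = Real.pi⁻¹ * (((k + 1)! : ℝ) * cosIntegral (k + 1) α) := by
        rw [realPartConst, hα]; ring
    _ ≤ _ := by gcongr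
    _ ≤ C * boundaryNorm (fun w : ℂ => (cauchyTransform g w).re) := h
    _ ≤ C := mul_le_of_le_one_right hC0 hn

/-! ### The complement of a convex set -/

theorem norm_iteratedDeriv_le_of_abs_re_le {f : ℂ → ℂ} {M : ℝ}
    (hf : DifferentiableOn ℂ f upperHalf) (hM : ∀ w ∈ upperHalf, |(f w).re| ≤ M) {z : ℂ}
    (hz : 0 < z.im) {s : ℕ} (hs : 1 ≤ s) :
    ‖iteratedDeriv s f z‖ ≤ realPartConst s / z.im ^ s * M := by
  have hM0 : 0 ≤ M := (abs_nonneg _).trans (hM z hz)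
  refine (norm_iteratedDeriv_le_boundaryNorm ⟨hf, M, by rintro _ ⟨w, hw, rfl⟩; exact hM w hw⟩
    hz hs).trans ?_
  gcongr
  · exact div_nonneg (realPartConst_nonneg s) (pow_nonneg hz.le s)
  · exact boundaryNorm_le hM0 (ae_abs_boundaryTrace_le hf hM)

theorem iteratedDeriv_comp_const_add_mul (f : ℂ → ℂ) (p c : ℂ) (n : ℕ) :
    iteratedDeriv n (fun w => f (p + c * w)) = fun w => c ^ n * iteratedDeriv n f (p + c * w) := by
  induction n with
  | zero => simp
  | succ n ih =>
    rw [iteratedDeriv_succ, ih]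
    ext w
    rw [deriv_const_mul_field, deriv_comp_mul_left c (fun w => iteratedDeriv n f (p + w)) w,
      deriv_comp_const_add, iteratedDeriv_succ, smul_eq_mul, pow_succ, mul_assoc]

/-- The estimate outside a convex set follows from the one in the half-plane that is bounded by the
supporting line at the point of `closure G` nearest to `z`. -/
theorem norm_iteratedDeriv_le_exteriorSet {G : Set ℂ} (hconv : Convex ℝ G) (hne : G.Nonempty)
    {f : ℂ → ℂ} (hf : HolomorphicBddRe (exteriorSet G) f) {z : ℂ} (hz : z ∈ exteriorSet G) {s : ℕ}
    (hs : 1 ≤ s) :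
    ‖iteratedDeriv s f z‖ ≤
      realPartConst s / Metric.infDist z (frontier (exteriorSet G)) ^ s *
        sSup ((fun w : ℂ => |(f w).re|) '' exteriorSet G) := by
  obtain ⟨p, hp, hpmin⟩ := exists_norm_eq_iInf_of_complete_convex hne.closure
    isClosed_closure.isComplete hconv.closure z
  rw [norm_eq_iInf_iff_real_inner_le_zero hconv.closure hp] at hpmin
  have hzp : z - p ≠ 0 := by
    rw [sub_ne_zero]
    rintro rfl
    exact hz hp
  set d := ‖z - p‖ with hd
  have hdpos : 0 < d := norm_pos_iff.2 hzp
  have hdC : (d : ℂ) ≠ 0 := by exact_mod_cast hdpos.ne'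
  -- `w ↦ p + c * w` maps the upper half-plane onto the supporting half-plane, and `d * i` to `z`
  set c : ℂ := -Complex.I * (z - p) / d with hc
  have hcnorm : ‖c‖ = 1 := by
    rw [hc, norm_div, norm_mul, norm_neg, Complex.norm_I, one_mul, Complex.norm_real,
      Real.norm_eq_abs, abs_of_pos hdpos, ← hd, div_self hdpos.ne']
  have hmem : ∀ w ∈ upperHalf, p + c * w ∈ exteriorSet G := by
    intro w hw hmem
    have h := hpmin _ hmem
    rw [add_sub_cancel_left, Complex.inner] at h
    have h1 : (starRingEnd ℂ) (z - p) * (c * w) = (d : ℂ) * (-Complex.I * w) := by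
      have h2 : (starRingEnd ℂ) (z - p) * (z - p) = (d : ℂ) ^ 2 := by
        rw [mul_comm, Complex.mul_conj, Complex.normSq_eq_norm_sq]
        push_cast
        rfl
      calc _ = ((starRingEnd ℂ) (z - p) * (z - p)) * (-Complex.I * w) / d := by rw [hc]; ring
        _ = _ := by rw [h2]; field_simp
    rw [mul_comm, h1, Complex.re_ofReal_mul] at h
    have h3 : (-Complex.I * w).re = w.im := by simp
    rw [h3] at h
    have : 0 < d * w.im := mul_pos hdpos hw
    linarith
  have hopen : IsOpen (exteriorSet G) := isClosed_closure.isOpen_compl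
  have hpfr : p ∈ frontier (exteriorSet G) := by
    rw [frontier_eq_closure_inter_closure]
    refine ⟨?_, subset_closure (by simpa [exteriorSet] using hp)⟩
    have hlim : Tendsto (fun ε : ℝ => p + c * ((ε : ℂ) * Complex.I)) (𝓝[>] 0) (𝓝 p) := by
      have hcont : Continuous fun ε : ℝ => p + c * ((ε : ℂ) * Complex.I) := by fun_prop
      have := hcont.tendsto 0
      simp only [Complex.ofReal_zero, zero_mul, mul_zero, add_zero] at this
      exact this.mono_left nhdsWithin_le_nhds
    refine mem_closure_of_tendsto hlim ?_
    filter_upwards [self_mem_nhdsWithin] with ε (hε : 0 < ε)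
    exact hmem _ (by simpa [upperHalf] using hε)
  have hdist : Metric.infDist z (frontier (exteriorSet G)) ≤ d := by
    rw [hd, ← dist_eq_norm]
    exact Metric.infDist_le_dist_of_mem hpfr
  have hpos : 0 < Metric.infDist z (frontier (exteriorSet G)) := by
    rw [← isClosed_frontier.notMem_iff_infDist_pos ⟨p, hpfr⟩]
    intro h
    exact (disjoint_frontier_iff_isOpen.2 hopen).le_bot ⟨h, hz⟩
  set S := sSup ((fun w : ℂ => |(f w).re|) '' exteriorSet G) with hS
  have hle : ∀ w ∈ exteriorSet G, |(f w).re| ≤ S := fun w hw =>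
    le_csSup hf.2 (mem_image_of_mem (fun w : ℂ => |(f w).re|) hw)
  have hS0 : 0 ≤ S := (abs_nonneg _).trans (hle z hz)
  have hcomp : DifferentiableOn ℂ (fun w => f (p + c * w)) upperHalf :=
    hf.1.comp (by fun_prop) hmem
  have hbd := norm_iteratedDeriv_le_of_abs_re_le hcomp (fun w hw => hle _ (hmem w hw))
    (z := (d : ℂ) * Complex.I) (by simpa using hdpos) hs
  have hAz : p + c * ((d : ℂ) * Complex.I) = z := by
    rw [hc]
    field_simp
    linear_combination (p - z) * Complex.I_sq
  rw [iteratedDeriv_comp_const_add_mul, norm_mul, norm_pow, hcnorm, one_pow, one_mul, hAz] at hbd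
  refine hbd.trans ?_
  have him : ((d : ℂ) * Complex.I).im = d := by simp
  rw [him]
  have := realPartConst_nonneg s
  gcongr

/-! ### Odd orders -/

/-- A trigonometric polynomial has constant average over sufficiently many equidistant points: only
the central term of the binomial expansion of `cos ^ (2 * l)` survives. -/
theorem sum_cos_add_pow (l : ℕ) {N : ℕ} (hN : l < N) (x : ℝ) :
    ∑ j ∈ Finset.range N, Real.cos (x + j * (Real.pi / N)) ^ (2 * l) =
      N * ((Nat.centralBinom l : ℝ) / 4 ^ l) := by
  have hN0 : (N : ℂ) ≠ 0 := by
    have : N ≠ 0 := by omega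
    exact_mod_cast this
  have hpi : (Real.pi : ℂ) ≠ 0 := by exact_mod_cast Real.pi_ne_zero
  have hterm : ∀ y : ℂ, Complex.cos y ^ (2 * l) = (4 ^ l)⁻¹ *
      ∑ m ∈ Finset.range (2 * l + 1),
        Complex.exp ((2 * m - 2 * l) * y * Complex.I) * ((2 * l).choose m : ℂ) := by
    intro y
    rw [Complex.cos, div_pow, add_pow, pow_mul, div_eq_inv_mul]
    norm_num
    refine Finset.sum_congr rfl fun m hm => ?_
    have hm' : m ≤ 2 * l := by simpa [Nat.lt_succ_iff] using hm
    rw [← Complex.exp_nat_mul, ← Complex.exp_nat_mul, ← Complex.exp_add]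
    congr 2
    push_cast [Nat.cast_sub hm']
    ring
  have hgeom : ∀ m ∈ Finset.range (2 * l + 1),
      ∑ j ∈ Finset.range N, Complex.exp ((2 * m - 2 * l) * (x + j * (Real.pi / N)) * Complex.I) =
        if m = l then (N : ℂ) else 0 := by
    intro m hm
    have hm' : m ≤ 2 * l := by simpa [Nat.lt_succ_iff] using hm
    split_ifs with hml
    · subst hml
      simp
    · set ζ : ℂ := Complex.exp ((2 * m - 2 * l) * (Real.pi / N) * Complex.I) with hζ
      have hsum : ∀ j ∈ Finset.range N,
          Complex.exp ((2 * m - 2 * l) * (x + j * (Real.pi / N)) * Complex.I) =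
            Complex.exp ((2 * m - 2 * l) * x * Complex.I) * ζ ^ j := by
        intro j _
        rw [hζ, ← Complex.exp_nat_mul, ← Complex.exp_add]
        congr 1
        ring
      have hζN : ζ ^ N = 1 := by
        rw [hζ, ← Complex.exp_nat_mul, Complex.exp_eq_one_iff]
        refine ⟨(m : ℤ) - l, ?_⟩
        push_cast
        field_simp
      have hζ1 : ζ ≠ 1 := by
        intro h
        rw [hζ, Complex.exp_eq_one_iff] at h
        obtain ⟨n, hn⟩ := h
        have h1 : ((m : ℂ) - l) = n * N := by
          have h2 : (2 * (m : ℂ) - 2 * l) * (Real.pi / N) * Complex.I =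
              ((m : ℂ) - l) * (2 * Real.pi * Complex.I) / N := by ring
          rw [h2, div_eq_iff hN0] at hn
          have h3 : (2 * Real.pi * Complex.I : ℂ) ≠ 0 := Complex.two_pi_I_ne_zero
          have : ((m : ℂ) - l) * (2 * Real.pi * Complex.I) = (n * N) * (2 * Real.pi * Complex.I) := by
            rw [hn]; ring
          exact mul_right_cancel₀ h3 this
        have h4 : (m : ℤ) - l = n * N := by exact_mod_cast h1
        rcases lt_trichotomy n 0 with hn0 | hn0 | hn0
        · nlinarith
        · rw [hn0] at h4
          omega
        · nlinarith
      rw [Finset.sum_congr rfl hsum, ← Finset.mul_sum, geom_sum_eq hζ1, hζN]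
      simp
  have hC : (∑ j ∈ Finset.range N, Complex.cos ((x : ℂ) + j * (Real.pi / N)) ^ (2 * l)) =
      N * ((Nat.centralBinom l : ℂ) / 4 ^ l) := by
    simp_rw [hterm]
    rw [← Finset.mul_sum, Finset.sum_comm]
    simp_rw [← Finset.sum_mul]
    rw [Finset.sum_congr rfl fun m hm => by rw [hgeom m hm]]
    simp only [ite_mul, zero_mul, Finset.sum_ite_eq', Finset.mem_range]
    rw [if_pos (by omega), Nat.centralBinom_eq_two_mul_choose]
    field_simp
  apply Complex.ofReal_injective
  push_cast
  exact hC

theorem integral_abs_cos_period (c : ℝ) : ∫ t in c..(c + Real.pi), |Real.cos t| = 2 := by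
  have hp : Function.Periodic (fun t => |Real.cos t|) Real.pi := fun t => by
    simp only [Real.cos_add_pi, abs_neg]
  rw [hp.intervalIntegral_add_eq c (-(Real.pi / 2)),
    show -(Real.pi / 2) + Real.pi = Real.pi / 2 by ring]
  have : ∫ t in (-(Real.pi / 2))..(Real.pi / 2), |Real.cos t| =
      ∫ t in (-(Real.pi / 2))..(Real.pi / 2), Real.cos t := by
    refine intervalIntegral.integral_congr fun t ht => ?_
    rw [uIcc_of_le (by linarith [Real.pi_pos])] at ht
    exact abs_of_nonneg (Real.cos_nonneg_of_mem_Icc ht)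
  rw [this, integral_cos]
  simp
  norm_num

theorem integral_abs_cos_add_mul {N : ℕ} (hN : N ≠ 0) (α : ℝ) :
    ∫ t in (-(Real.pi / 2))..(Real.pi / 2), |Real.cos (α + N * t)| = 2 := by
  have hp : Function.Periodic (fun t => |Real.cos t|) Real.pi := fun t => by
    simp only [Real.cos_add_pi, abs_neg]
  have hN' : (N : ℝ) ≠ 0 := by exact_mod_cast hN
  have h := intervalIntegral.integral_comp_add_mul (a := -(Real.pi / 2)) (b := Real.pi / 2)
    (fun t => |Real.cos t|) hN' α
  rw [h]
  have h2 := hp.intervalIntegral_add_zsmul_eq N (α + N * -(Real.pi / 2))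
    (fun a b => (Real.continuous_cos.abs).intervalIntegrable a b)
  rw [show α + N * -(Real.pi / 2) + (N : ℤ) • Real.pi = α + N * (Real.pi / 2) by
    rw [zsmul_eq_mul, Int.cast_natCast]; ring, integral_abs_cos_period] at h2
  rw [h2]
  simp [hN']

/-- For odd order the integral does not depend on `α`. -/
theorem cosIntegral_odd (l : ℕ) (α : ℝ) :
    cosIntegral (2 * l + 1) α = 2 * ((Nat.centralBinom l : ℝ) / 4 ^ l) := by
  set N : ℕ := 2 * l + 2 with hNdef
  have hN0 : (N : ℝ) ≠ 0 := by positivity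
  have hdef : cosIntegral (2 * l + 1) α = ∫ t in (-(Real.pi / 2))..(Real.pi / 2),
      |Real.cos (α + N * t)| * Real.cos t ^ (2 * l) := by
    rw [cosIntegral, Nat.add_sub_cancel, hNdef]
    congr 1
    ext t
    congr 4
    push_cast
    ring
  set h : ℝ → ℝ := fun t => |Real.cos (α + N * t)| * Real.cos t ^ (2 * l) with hh
  have hper : Function.Periodic h Real.pi := by
    intro t
    simp only [hh]
    rw [mul_add, ← add_assoc, Real.cos_add_nat_mul_pi, Real.cos_add_pi, abs_mul, abs_pow, abs_neg,
      abs_one, one_pow, one_mul, Even.neg_pow (even_two_mul l)]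
  have hshift : ∀ j : ℕ, ∫ t in (-(Real.pi / 2))..(Real.pi / 2),
      |Real.cos (α + N * t)| * Real.cos (t + j * (Real.pi / N)) ^ (2 * l) =
        cosIntegral (2 * l + 1) α := by
    intro j
    have h1 : ∀ t, |Real.cos (α + N * t)| * Real.cos (t + j * (Real.pi / N)) ^ (2 * l) =
        h (t + j * (Real.pi / N)) := by
      intro t
      simp only [hh]
      have h3 : α + N * (t + j * (Real.pi / N)) = α + N * t + j * Real.pi := by
        field_simp
        ring
      rw [h3, Real.cos_add_nat_mul_pi, abs_mul, abs_pow, abs_neg,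
        abs_one, one_pow, one_mul]
    simp_rw [h1]
    rw [intervalIntegral.integral_comp_add_right h, hdef]
    have h2 := hper.intervalIntegral_add_eq (-(Real.pi / 2) + j * (Real.pi / N)) (-(Real.pi / 2))
    rw [show -(Real.pi / 2) + Real.pi = Real.pi / 2 by ring, show
      -(Real.pi / 2) + j * (Real.pi / N) + Real.pi = Real.pi / 2 + j * (Real.pi / N) by ring] at h2
    exact h2
  have hsum : (N : ℝ) * cosIntegral (2 * l + 1) α =
      N * (2 * ((Nat.centralBinom l : ℝ) / 4 ^ l)) := by
    calc (N : ℝ) * cosIntegral (2 * l + 1) α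
        = ∑ j ∈ Finset.range N, ∫ t in (-(Real.pi / 2))..(Real.pi / 2),
          |Real.cos (α + N * t)| * Real.cos (t + j * (Real.pi / N)) ^ (2 * l) := by
          simp only [hshift, Finset.sum_const, Finset.card_range, nsmul_eq_mul]
      _ = ∫ t in (-(Real.pi / 2))..(Real.pi / 2), ∑ j ∈ Finset.range N,
          |Real.cos (α + N * t)| * Real.cos (t + j * (Real.pi / N)) ^ (2 * l) := by
          rw [intervalIntegral.integral_finsetSum]
          intro j _
          exact Continuous.intervalIntegrable (by fun_prop) _ _
      _ = ∫ t in (-(Real.pi / 2))..(Real.pi / 2),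
          |Real.cos (α + N * t)| * (N * ((Nat.centralBinom l : ℝ) / 4 ^ l)) := by
          simp_rw [← Finset.mul_sum, sum_cos_add_pow l (show l < N by omega)]
      _ = _ := by
          rw [intervalIntegral.integral_mul_const, integral_abs_cos_add_mul (by omega)]
          ring
  exact mul_left_cancel₀ hN0 hsum

theorem factorial_mul_centralBinom (l : ℕ) :
    (2 * l + 1)! * (2 * l + 1) * Nat.centralBinom l = ((2 * l + 1)‼) ^ 2 * 4 ^ l := by
  induction l with
  | zero => simp
  | succ l ih =>
    have hc := Nat.succ_mul_centralBinom_succ l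
    have hf : (2 * (l + 1) + 1)! = (2 * l + 3) * ((2 * l + 2) * (2 * l + 1)!) := by
      rw [show 2 * (l + 1) + 1 = (2 * l + 1 + 1) + 1 by ring, Nat.factorial_succ,
        Nat.factorial_succ]
    have hd : (2 * (l + 1) + 1)‼ = (2 * l + 3) * (2 * l + 1)‼ := by
      rw [show 2 * (l + 1) + 1 = (2 * l + 1) + 2 by ring, Nat.doubleFactorial_add_two]
    rw [hf, hd]
    calc (2 * l + 3) * ((2 * l + 2) * (2 * l + 1)!) * (2 * (l + 1) + 1) * Nat.centralBinom (l + 1)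
        = (2 * l + 3) ^ 2 * 2 * (2 * l + 1)! * ((l + 1) * Nat.centralBinom (l + 1)) := by ring
      _ = (2 * l + 3) ^ 2 * 4 * ((2 * l + 1)! * (2 * l + 1) * Nat.centralBinom l) := by
          rw [hc]; ring
      _ = _ := by rw [ih]; ring

theorem realPartConst_odd (l : ℕ) : realPartConst (2 * l + 1) =
    2 * (((2 * l + 1)‼ : ℕ) : ℝ) ^ 2 / (Real.pi * (2 * (l : ℝ) + 1)) := by
  have hr : range (cosIntegral (2 * l + 1)) = {2 * ((Nat.centralBinom l : ℝ) / 4 ^ l)} := by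
    ext v
    simp [cosIntegral_odd, eq_comm]
  rw [realPartConst, hr, csSup_singleton]
  have h : ((2 * l + 1)! : ℝ) * (2 * l + 1) * Nat.centralBinom l =
      (((2 * l + 1)‼ : ℕ) : ℝ) ^ 2 * 4 ^ l := by
    exact_mod_cast factorial_mul_centralBinom l
  have hpi := Real.pi_ne_zero
  have h2 : (2 * (l : ℝ) + 1) ≠ 0 := by positivity
  rw [eq_div_iff (mul_ne_zero hpi h2)]
  field_simp
  linear_combination h

/-! ### Orders two and four -/

section

variable {h k F : ℝ → ℝ} {a b : ℝ}

theorem integral_abs_mul_of_nonneg (hh : Continuous h) (hk : Continuous k)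
    (hF : ∀ t, HasDerivAt F (h t * k t) t) (hab : a ≤ b) (hs : ∀ t ∈ Icc a b, 0 ≤ h t) :
    ∫ t in a..b, |h t| * k t = F b - F a := by
  rw [← intervalIntegral.integral_eq_sub_of_hasDerivAt (fun t _ => hF t)
    ((hh.mul hk).intervalIntegrable _ _)]
  refine intervalIntegral.integral_congr fun t ht => ?_
  rw [uIcc_of_le hab] at ht
  simp only [abs_of_nonneg (hs t ht)]

theorem integral_abs_mul_of_nonpos (hh : Continuous h) (hk : Continuous k)
    (hF : ∀ t, HasDerivAt F (h t * k t) t) (hab : a ≤ b) (hs : ∀ t ∈ Icc a b, h t ≤ 0) :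
    ∫ t in a..b, |h t| * k t = F a - F b := by
  have := integral_abs_mul_of_nonneg (h := fun t => -h t) hh.neg hk (F := fun t => -F t)
    (fun t => (hF t).neg.congr_deriv (by ring)) hab (fun t ht => neg_nonneg.2 (hs t ht))
  simp only [abs_neg] at this
  rw [this]
  ring

end

theorem sin_nonneg_of_shift {x : ℝ} (n : ℤ) (h1 : 2 * n * Real.pi ≤ x)
    (h2 : x ≤ (2 * n + 1) * Real.pi) : 0 ≤ Real.sin x := by
  rw [← Real.sin_sub_int_mul_two_pi x n]
  exact Real.sin_nonneg_of_nonneg_of_le_pi (by linarith) (by linarith)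

theorem sin_nonpos_of_shift {x : ℝ} (n : ℤ) (h1 : (2 * n - 1) * Real.pi ≤ x)
    (h2 : x ≤ 2 * n * Real.pi) : Real.sin x ≤ 0 := by
  rw [← Real.sin_sub_int_mul_two_pi x n]
  exact Real.sin_nonpos_of_nonpos_of_neg_pi_le (by linarith) (by linarith)

theorem hasDerivAt_cos_add_mul (γ m t : ℝ) :
    HasDerivAt (fun t => Real.cos (γ + m * t)) (-Real.sin (γ + m * t) * m) t := by
  have h : HasDerivAt (fun t : ℝ => γ + m * t) m t := by
    simpa using ((hasDerivAt_id t).const_mul m).const_add γ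
  exact h.cos

/-- Closed form over one period in `α = γ + π / 2`. The zeros of `sin (γ + 3 * t)` in
`[-π / 2, π / 2]` are `(n * π - γ) / 3` for `n = -1, 0, 1`; the integral is split there. -/
theorem cosIntegral_two {γ : ℝ} (h1 : -(Real.pi / 2) ≤ γ) (h2 : γ ≤ Real.pi / 2) :
    cosIntegral 2 (γ + Real.pi / 2) = 3 / 2 * Real.cos (γ / 3) - 1 / 4 * Real.cos γ := by
  have hpi := Real.pi_pos
  set h : ℝ → ℝ := fun t => Real.sin (γ + 3 * t) with hh
  set F : ℝ → ℝ := fun t => -(Real.cos (γ + 4 * t) / 8 + Real.cos (γ + 2 * t) / 4) with hF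
  have hhc : Continuous h := by fun_prop
  have hFd : ∀ t, HasDerivAt F (h t * Real.cos t) t := by
    intro t
    refine (((hasDerivAt_cos_add_mul γ 4 t).div_const 8).add
      ((hasDerivAt_cos_add_mul γ 2 t).div_const 4)).neg.congr_deriv ?_
    have e1 : γ + 4 * t = (γ + 3 * t) + t := by ring
    have e2 : γ + 2 * t = (γ + 3 * t) - t := by ring
    rw [e1, e2, Real.sin_add, Real.sin_sub]
    ring
  have hdef : cosIntegral 2 (γ + Real.pi / 2) =
      ∫ t in (-(Real.pi / 2))..(Real.pi / 2), |h t| * Real.cos t := by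
    unfold cosIntegral
    congr 1
    ext t
    rw [show γ + Real.pi / 2 + ((2 : ℕ) + 1 : ℝ) * t = (γ + 3 * t) + Real.pi / 2 by
      push_cast; ring, Real.cos_add_pi_div_two, abs_neg, Nat.add_one_sub_one, pow_one]
  have hint : ∀ a b, IntervalIntegrable (fun t => |h t| * Real.cos t) volume a b := fun a b =>
    Continuous.intervalIntegrable (by fun_prop) _ _
  rw [hdef, ← intervalIntegral.integral_add_adjacent_intervals (hint _ (-(Real.pi / 3) - γ / 3))
      (hint _ _),
    ← intervalIntegral.integral_add_adjacent_intervals (hint _ (-(γ / 3))) (hint _ (Real.pi / 2)),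
    ← intervalIntegral.integral_add_adjacent_intervals (hint _ (Real.pi / 3 - γ / 3))
      (hint _ (Real.pi / 2)),
    integral_abs_mul_of_nonneg hhc Real.continuous_cos hFd (by linarith)
      (fun t ht => sin_nonneg_of_shift (-1) (by push_cast; linarith [ht.1])
        (by push_cast; linarith [ht.2])),
    integral_abs_mul_of_nonpos hhc Real.continuous_cos hFd (by linarith)
      (fun t ht => sin_nonpos_of_shift 0 (by push_cast; linarith [ht.1])
        (by push_cast; linarith [ht.2])),
    integral_abs_mul_of_nonneg hhc Real.continuous_cos hFd (by linarith)
      (fun t ht => sin_nonneg_of_shift 0 (by push_cast; linarith [ht.1])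
        (by push_cast; linarith [ht.2])),
    integral_abs_mul_of_nonpos hhc Real.continuous_cos hFd (by linarith)
      (fun t ht => sin_nonpos_of_shift 1 (by push_cast; linarith [ht.1])
        (by push_cast; linarith [ht.2]))]
  have e1 : F (-(Real.pi / 2)) = Real.cos γ / 8 := by
    simp only [hF]
    rw [show γ + 4 * -(Real.pi / 2) = γ - 2 * Real.pi by ring,
      show γ + 2 * -(Real.pi / 2) = γ - Real.pi by ring, Real.cos_sub_two_pi, Real.cos_sub_pi]
    ring
  have e2 : F (Real.pi / 2) = Real.cos γ / 8 := by
    simp only [hF]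
    rw [show γ + 4 * (Real.pi / 2) = γ + 2 * Real.pi by ring,
      show γ + 2 * (Real.pi / 2) = γ + Real.pi by ring, Real.cos_add_two_pi, Real.cos_add_pi]
    ring
  have e3 : F (-(γ / 3)) = -(3 / 8) * Real.cos (γ / 3) := by
    simp only [hF]
    rw [show γ + 4 * -(γ / 3) = -(γ / 3) by ring, show γ + 2 * -(γ / 3) = γ / 3 by ring,
      Real.cos_neg]
    ring
  have e4 : F (-(Real.pi / 3) - γ / 3) = 3 / 8 * Real.cos (γ / 3 + Real.pi / 3) := by
    simp only [hF]
    rw [show γ + 4 * (-(Real.pi / 3) - γ / 3) = -((γ / 3 + Real.pi / 3) + Real.pi) by ring,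
      show γ + 2 * (-(Real.pi / 3) - γ / 3) = (γ / 3 + Real.pi / 3) - Real.pi by ring,
      Real.cos_neg, Real.cos_add_pi, Real.cos_sub_pi]
    ring
  have e5 : F (Real.pi / 3 - γ / 3) = 3 / 8 * Real.cos (γ / 3 - Real.pi / 3) := by
    simp only [hF]
    rw [show γ + 4 * (Real.pi / 3 - γ / 3) = Real.pi - (γ / 3 - Real.pi / 3) by ring,
      show γ + 2 * (Real.pi / 3 - γ / 3) = (γ / 3 - Real.pi / 3) + Real.pi by ring,
      Real.cos_pi_sub, Real.cos_add_pi]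
    ring
  rw [e1, e2, e3, e4, e5, Real.cos_add, Real.cos_sub, Real.cos_pi_div_three]
  ring

/-- Closed form over one period in `α = γ + π / 2`. The zeros of `sin (γ + 5 * t)` in
`[-π / 2, π / 2]` are `(n * π - γ) / 5` for `n = -2, …, 2`; the integral is split there. -/
theorem cosIntegral_four {γ : ℝ} (h1 : -(Real.pi / 2) ≤ γ) (h2 : γ ≤ Real.pi / 2) :
    cosIntegral 4 (γ + Real.pi / 2) = 5 * (√5 + 1) / 16 * Real.cos (γ / 5) -
      5 * (√5 - 1) / 32 * Real.cos (3 * (γ / 5)) + 1 / 32 * Real.cos γ := by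
  have hpi := Real.pi_pos
  set h : ℝ → ℝ := fun t => Real.sin (γ + 5 * t) with hh
  set F : ℝ → ℝ := fun t => -(Real.cos (γ + 6 * t) / 16 + 3 * Real.cos (γ + 4 * t) / 32 +
    Real.cos (γ + 8 * t) / 64 + Real.cos (γ + 2 * t) / 16) with hF
  have hhc : Continuous h := by fun_prop
  have hkc : Continuous fun t => Real.cos t ^ 3 := by fun_prop
  have hFd : ∀ t, HasDerivAt F (h t * Real.cos t ^ 3) t := by
    intro t
    refine (((((hasDerivAt_cos_add_mul γ 6 t).div_const 16).add
      (((hasDerivAt_cos_add_mul γ 4 t).const_mul 3).div_const 32)).add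
      ((hasDerivAt_cos_add_mul γ 8 t).div_const 64)).add
      ((hasDerivAt_cos_add_mul γ 2 t).div_const 16)).neg.congr_deriv ?_
    have hc3 : Real.cos t ^ 3 = (3 * Real.cos t + Real.cos (3 * t)) / 4 := by
      rw [Real.cos_three_mul]; ring
    rw [hc3, show γ + 6 * t = (γ + 5 * t) + t by ring, show γ + 4 * t = (γ + 5 * t) - t by ring,
      show γ + 8 * t = (γ + 5 * t) + 3 * t by ring, show γ + 2 * t = (γ + 5 * t) - 3 * t by ring]
    simp only [hh]
    generalize γ + 5 * t = u
    rw [Real.sin_add, Real.sin_sub, Real.sin_add, Real.sin_sub]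
    ring
  have hdef : cosIntegral 4 (γ + Real.pi / 2) =
      ∫ t in (-(Real.pi / 2))..(Real.pi / 2), |h t| * Real.cos t ^ 3 := by
    unfold cosIntegral
    congr 1
    ext t
    rw [show γ + Real.pi / 2 + ((4 : ℕ) + 1 : ℝ) * t = (γ + 5 * t) + Real.pi / 2 by
      push_cast; ring, Real.cos_add_pi_div_two, abs_neg]
  have hint : ∀ a b, IntervalIntegrable (fun t => |h t| * Real.cos t ^ 3) volume a b := fun a b =>
    Continuous.intervalIntegrable (by fun_prop) _ _
  rw [hdef,
    ← intervalIntegral.integral_add_adjacent_intervals (hint _ (-(2 * (Real.pi / 5)) - γ / 5))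
      (hint _ _),
    ← intervalIntegral.integral_add_adjacent_intervals (hint _ (-(Real.pi / 5) - γ / 5))
      (hint _ (Real.pi / 2)),
    ← intervalIntegral.integral_add_adjacent_intervals (hint _ (-(γ / 5))) (hint _ (Real.pi / 2)),
    ← intervalIntegral.integral_add_adjacent_intervals (hint _ (Real.pi / 5 - γ / 5))
      (hint _ (Real.pi / 2)),
    ← intervalIntegral.integral_add_adjacent_intervals (hint _ (2 * (Real.pi / 5) - γ / 5))
      (hint _ (Real.pi / 2)),
    integral_abs_mul_of_nonpos hhc hkc hFd (by linarith)
      (fun t ht => sin_nonpos_of_shift (-1) (by push_cast; linarith [ht.1])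
        (by push_cast; linarith [ht.2])),
    integral_abs_mul_of_nonneg hhc hkc hFd (by linarith)
      (fun t ht => sin_nonneg_of_shift (-1) (by push_cast; linarith [ht.1])
        (by push_cast; linarith [ht.2])),
    integral_abs_mul_of_nonpos hhc hkc hFd (by linarith)
      (fun t ht => sin_nonpos_of_shift 0 (by push_cast; linarith [ht.1])
        (by push_cast; linarith [ht.2])),
    integral_abs_mul_of_nonneg hhc hkc hFd (by linarith)
      (fun t ht => sin_nonneg_of_shift 0 (by push_cast; linarith [ht.1])
        (by push_cast; linarith [ht.2])),
    integral_abs_mul_of_nonpos hhc hkc hFd (by linarith)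
      (fun t ht => sin_nonpos_of_shift 1 (by push_cast; linarith [ht.1])
        (by push_cast; linarith [ht.2])),
    integral_abs_mul_of_nonneg hhc hkc hFd (by linarith)
      (fun t ht => sin_nonneg_of_shift 1 (by push_cast; linarith [ht.1])
        (by push_cast; linarith [ht.2]))]
  have e1 : F (-(Real.pi / 2)) = Real.cos γ / 64 := by
    simp only [hF]
    rw [show γ + 6 * -(Real.pi / 2) = γ - Real.pi - 2 * Real.pi by ring,
      show γ + 4 * -(Real.pi / 2) = γ - 2 * Real.pi by ring,
      show γ + 8 * -(Real.pi / 2) = γ - 2 * Real.pi - 2 * Real.pi by ring,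
      show γ + 2 * -(Real.pi / 2) = γ - Real.pi by ring]
    simp only [Real.cos_sub_two_pi, Real.cos_sub_pi]
    ring
  have e2 : F (Real.pi / 2) = Real.cos γ / 64 := by
    simp only [hF]
    rw [show γ + 6 * (Real.pi / 2) = γ + Real.pi + 2 * Real.pi by ring,
      show γ + 4 * (Real.pi / 2) = γ + 2 * Real.pi by ring,
      show γ + 8 * (Real.pi / 2) = γ + 2 * Real.pi + 2 * Real.pi by ring,
      show γ + 2 * (Real.pi / 2) = γ + Real.pi by ring]
    simp only [Real.cos_add_two_pi, Real.cos_add_pi]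
    ring
  -- the value at a zero `t = (n * π - γ) / 5` of `h`
  have hval : ∀ (n : ℤ) (t : ℝ), γ + 5 * t = n * Real.pi →
      F t = -((-1) ^ n * (5 / 32 * Real.cos t + 5 / 64 * Real.cos (3 * t))) := by
    intro n t ht
    simp only [hF]
    rw [show γ + 6 * t = t + n * Real.pi by linarith, show γ + 4 * t = -t + n * Real.pi by linarith,
      show γ + 8 * t = 3 * t + n * Real.pi by linarith,
      show γ + 2 * t = -(3 * t) + n * Real.pi by linarith]
    simp only [Real.cos_add_int_mul_pi, Real.cos_neg]
    ring
  have hc5 := Real.cos_pi_div_five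
  have hs5 : √5 ^ 2 = 5 := Real.sq_sqrt (by norm_num)
  set A := Real.pi / 5 with hA
  set g := γ / 5 with hg
  have hc2 : Real.cos (2 * A) = (√5 - 1) / 4 := by
    rw [Real.cos_two_mul, hc5]; linear_combination hs5 / 8
  have hc3 : Real.cos (3 * A) = (1 - √5) / 4 := by
    rw [show 3 * A = Real.pi - 2 * A by rw [hA]; ring, Real.cos_pi_sub, hc2]; ring
  have hc6 : Real.cos (6 * A) = -(1 + √5) / 4 := by
    rw [show 6 * A = A + Real.pi by rw [hA]; ring, Real.cos_add_pi, hc5]; ring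
  rw [e1, e2, hval (-2) (-(2 * A) - g) (by rw [hA, hg]; push_cast; ring),
    hval (-1) (-A - g) (by rw [hA, hg]; push_cast; ring),
    hval 0 (-g) (by rw [hg]; push_cast; ring),
    hval 1 (A - g) (by rw [hA, hg]; push_cast; ring),
    hval 2 (2 * A - g) (by rw [hA, hg]; push_cast; ring)]
  rw [show 3 * (-(2 * A) - g) = -(6 * A) - 3 * g by ring,
    show 3 * (-A - g) = -(3 * A) - 3 * g by ring,
    show 3 * -g = -(3 * g) by ring, show 3 * (A - g) = 3 * A - 3 * g by ring,
    show 3 * (2 * A - g) = 6 * A - 3 * g by ring]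
  simp only [Real.cos_sub, Real.cos_neg, Real.sin_neg, hc2, hc3, hc5, hc6]
  norm_num
  ring

/-- The maximum is attained at `α = 0` modulo `π`, an end point of the period used. -/
theorem realPartConst_two : realPartConst 2 = 3 * √3 / (2 * Real.pi) := by
  have hpi := Real.pi_pos
  have hs : √3 ^ 2 = 3 := Real.sq_sqrt (by norm_num)
  have hs0 : 0 ≤ √3 := Real.sqrt_nonneg 3
  have hmax : sSup (range (cosIntegral 2)) = 3 * √3 / 4 := by
    refine le_antisymm (csSup_le (range_nonempty _) ?_) ?_
    · rintro _ ⟨α, rfl⟩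
      obtain ⟨α', hα', hα⟩ := (periodic_cosIntegral 2).exists_mem_Ico₀ hpi α
      rw [hα, show α' = (α' - Real.pi / 2) + Real.pi / 2 by ring,
        cosIntegral_two (by linarith [hα'.1]) (by linarith [hα'.2])]
      set γ := α' - Real.pi / 2 with hγ
      set x := Real.cos (γ / 3) with hx
      have hcos : Real.cos γ = 4 * x ^ 3 - 3 * x := by
        rw [hx, ← Real.cos_three_mul]
        congr 1
        ring
      have hx0 : 0 ≤ x := Real.cos_nonneg_of_mem_Icc
        ⟨by linarith [hα'.1], by linarith [hα'.2]⟩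
      rw [hcos]
      -- the difference is `(x - √3 / 2) ^ 2 * (x + √3)`
      nlinarith [mul_nonneg (sq_nonneg (x - √3 / 2)) (add_nonneg hx0 hs0)]
    · have h := cosIntegral_le 2 (Real.pi / 2 + Real.pi / 2)
      rw [cosIntegral_two (by linarith) le_rfl, Real.cos_pi_div_two,
        show Real.pi / 2 / 3 = Real.pi / 6 by ring, Real.cos_pi_div_six] at h
      linarith
  rw [realPartConst, hmax]
  simp only [Nat.factorial_two, Nat.cast_ofNat]
  field_simp
  ring

/-- The maximum is attained at `α = π / 2`, the midpoint of the period used. -/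
theorem realPartConst_four : realPartConst 4 = 3 * (16 + 5 * √5) / (4 * Real.pi) := by
  have hpi := Real.pi_pos
  have hs : √5 ^ 2 = 5 := Real.sq_sqrt (by norm_num)
  have hmax : sSup (range (cosIntegral 4)) = (16 + 5 * √5) / 32 := by
    refine le_antisymm (csSup_le (range_nonempty _) ?_) ?_
    · rintro _ ⟨α, rfl⟩
      obtain ⟨α', hα', hα⟩ := (periodic_cosIntegral 4).exists_mem_Ico₀ hpi α
      rw [hα, show α' = (α' - Real.pi / 2) + Real.pi / 2 by ring,
        cosIntegral_four (by linarith [hα'.1]) (by linarith [hα'.2])]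
      set γ := α' - Real.pi / 2 with hγ
      set x := Real.cos (γ / 5) with hx
      have hcos : Real.cos γ = 16 * x ^ 5 - 20 * x ^ 3 + 5 * x := by
        have h1 : γ = 2 * (γ / 5) + 3 * (γ / 5) := by ring
        have h2 : Real.sin (3 * (γ / 5)) * Real.sin (2 * (γ / 5)) =
            (1 - x ^ 2) * (8 * x ^ 3 - 2 * x) := by
          rw [Real.sin_three_mul, Real.sin_two_mul]
          have h3 := Real.sin_sq_add_cos_sq (γ / 5)
          rw [← hx] at h3 ⊢
          have h4 : Real.sin (γ / 5) ^ 2 = 1 - x ^ 2 := by linarith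
          calc _ = Real.sin (γ / 5) ^ 2 * (3 - 4 * Real.sin (γ / 5) ^ 2) * (2 * x) := by ring
            _ = _ := by rw [h4]; ring
        rw [h1, Real.cos_add, mul_comm (Real.sin _), h2, Real.cos_two_mul, Real.cos_three_mul, ← hx]
        ring
      have hx1 : x ≤ 1 := Real.cos_le_one _
      -- `|γ / 5| ≤ π / 10`, and `cos (π / 10) = 0.951…`
      have hx0 : 19 / 20 ≤ x := by
        have h1 := Real.one_sub_sq_div_two_le_cos (x := γ / 5)
        have h2 : (γ / 5) ^ 2 ≤ (Real.pi / 10) ^ 2 :=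
          sq_le_sq' (by linarith [hα'.1]) (by linarith [hα'.2])
        have h3 : Real.pi ^ 2 ≤ 3.15 ^ 2 := by gcongr; exact Real.pi_lt_d2.le
        linarith
      rw [hcos, Real.cos_three_mul, ← hx]
      have hs1 : √5 ≤ 2.237 := by
        rw [Real.sqrt_le_left (by norm_num)]; norm_num
      have hs2 : 2.236 ≤ √5 := Real.le_sqrt_of_sq_le (by norm_num)
      -- the factor that remains after splitting off `1 - x`
      have hq : 0 ≤ 5 * (√5 + 1) / 16 - 5 * (√5 - 1) / 32 * (2 * x + 1) ^ 2 +
          1 / 32 * (4 * x ^ 2 + 2 * x - 1) ^ 2 := by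
        have h1 : (2 * x + 1) ^ 2 ≤ 9 - 11.8 * (1 - x) := by nlinarith
        have h2 : 25 - 100 * (1 - x) ≤ (4 * x ^ 2 + 2 * x - 1) ^ 2 := by
          have : 0 ≤ (1 - x) ^ 2 * (140 - 80 * (1 - x) + 16 * (1 - x) ^ 2) :=
            mul_nonneg (sq_nonneg _) (by nlinarith)
          nlinarith
        have h3 : (√5 - 1) * (2 * x + 1) ^ 2 ≤ 1.237 * (9 - 11.8 * (1 - x)) :=
          mul_le_mul (by linarith) h1 (sq_nonneg _) (by norm_num)
        linarith
      nlinarith [mul_nonneg (sub_nonneg.2 hx1) hq]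
    · have h := cosIntegral_le 4 (0 + Real.pi / 2)
      rw [cosIntegral_four (by linarith) (by linarith)] at h
      simp only [zero_div, mul_zero, Real.cos_zero, mul_one] at h
      linarith
  rw [realPartConst, hmax, show (4 : ℕ)! = 24 by rfl]
  push_cast
  field_simp
  ring

theorem theorem3 :
    -- the maximum over `α` in the definition of `K_s` is attained
    (∀ s : ℕ, 1 ≤ s → IsGreatest (range (cosIntegral s)) (sSup (range (cosIntegral s)))) ∧
    -- the estimate in the complement of the closure of a convex domain
    (∀ G : Set ℂ, IsOpen G → Convex ℝ G → G.Nonempty →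
      ∀ f : ℂ → ℂ, HolomorphicBddRe (exteriorSet G) f →
      ∀ z ∈ exteriorSet G, ∀ s : ℕ, 1 ≤ s →
        ‖iteratedDeriv s f z‖ ≤
          realPartConst s / Metric.infDist z (frontier (exteriorSet G)) ^ s *
            sSup ((fun w : ℂ => |(f w).re|) '' exteriorSet G)) ∧
    -- in the half-plane, the boundary values of `Re f` exist a.e. and lie in `L^∞`
    (∀ f : ℂ → ℂ, HolomorphicBddRe upperHalf f →
      (∀ᵐ x : ℝ, Tendsto (fun y : ℝ => (f ((x : ℂ) + (y : ℂ) * Complex.I)).re) (𝓝[>] (0 : ℝ))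
        (𝓝 (boundaryTrace (fun w : ℂ => (f w).re) x))) ∧
      MemLp (boundaryTrace (fun w : ℂ => (f w).re)) ⊤ (volume : Measure ℝ)) ∧
    -- `K_s` is the best constant in the half-plane inequality
    (∀ s : ℕ, 1 ≤ s →
      IsLeast {C : ℝ | ∀ f : ℂ → ℂ, HolomorphicBddRe upperHalf f → ∀ z ∈ upperHalf,
        ‖iteratedDeriv s f z‖ ≤ C / z.im ^ s * boundaryNorm (fun w : ℂ => (f w).re)}
        (realPartConst s)) ∧
    -- explicit values
    (∀ l : ℕ, realPartConst (2 * l + 1) =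
      2 * (((2 * l + 1)‼ : ℕ) : ℝ) ^ 2 / (Real.pi * (2 * (l : ℝ) + 1))) ∧
    realPartConst 2 = 3 * Real.sqrt 3 / (2 * Real.pi) ∧
    realPartConst 4 = 3 * (16 + 5 * Real.sqrt 5) / (4 * Real.pi) := by
  refine ⟨fun s _ => isGreatest_sSup_range_cosIntegral s,
    fun G _ hconv hne f hf z hz s hs => norm_iteratedDeriv_le_exteriorSet hconv hne hf hz hs,
    fun f hf => ?_, fun s hs => ⟨fun f hf z hz => norm_iteratedDeriv_le_boundaryNorm hf hz hs,
      fun C hC => realPartConst_le_of_bound hs hC⟩,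
    realPartConst_odd, realPartConst_two, realPartConst_four⟩
  obtain ⟨hd, M, hM⟩ := hf
  have hM' : ∀ w ∈ upperHalf, |(f w).re| ≤ M := fun w hw => hM (mem_image_of_mem _ hw)
  exact ⟨ae_tendsto_boundaryTrace hd hM', memLp_boundaryTrace hd hM'⟩
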